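/- There is a (necessarily unique) real sequence $(c_\ell)_{\ell\ge 0}$ such that $$\frac{\cosh^{-1}(1+z/2)}{\sqrt z}=\sum_{\ell=0}^\infty c_\ell z^\ell\qquad(0<z<4),$$ and the following holds. Let $C>0$ and $\beta>0$, and let $\mu$ be the spectral measure of the Jacobi matrix with parameters $a_n\equiv 1$, $b_n=-Cn^{-\beta}$ ($n\ge 1$); that is, $\mu$ is a compactly supported probability measure on $\mathbb R$ whose orthonormal polynomials $p_n$ (of degree $n$, with positive leading coefficient) satisfy $xp_n=a_{n+1}p_{n+1}+b_{n+1}p_n+a_np_{n-1}$ for $n\ge 0$, where $p_{-1}=0$. Then there is a (necessarily unique) continuous function $Q:(-2,2)\to\mathbb R$ such that $$d\mu(x)=e^{-2Q(x)}\,dx\quad\text{on }(-2,2),$$ and, with $\delta=2-x$, as $x\uparrow 2$, $$Q(x)=\beta^{-1}C^{1/\beta}\sum_{0\le \ell<\frac1\beta-\frac12}c_\ell\,\frac{\Gamma(\ell+\frac32)\,\Gamma(\frac1\beta-\frac12-\ell)}{\Gamma(\frac1\beta+1)}\,\delta^{-\frac1\beta+\ell+\frac12}+O(\log\delta).$$ In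 particular, if $0<\beta<\frac23$, then as $x\uparrow 2$ $$Q(x)=\beta^{-1}C^{1/\beta}\,\frac{\Gamma(\frac32)\,\Gamma(\frac1\beta-\frac12)}{\Gamma(\frac1\beta+1)}\,(2-x)^{\frac12-\frac1\beta}\bigl(1+O(2-x)\bigr).$$ The constants in the $O$-terms may depend on $C$ and $\beta$. -/

import Mathlib

open MeasureTheory Set Filter Topology Asymptotics

/-- `p 0, p 1, …` are the orthonormal polynomials of the measure `μ`: `p n` has degree `n` and
positive leading coefficient, and `∫ p m * p n ∂μ` is `1` if `m = n` and `0` otherwise. -/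
structure IsOrthonormalPolynomials (μ : Measure ℝ) (p : ℕ → Polynomial ℝ) : Prop where
  natDegree_eq : ∀ n, (p n).natDegree = n
  leadingCoeff_pos : ∀ n, 0 < (p n).leadingCoeff
  orthonormal : ∀ m n, ∫ x, (p m).eval x * (p n).eval x ∂μ = if m = n then 1 else 0

/-- `μ` is the spectral measure of the Jacobi matrix with off-diagonal entries `a 1, a 2, … > 0` and
diagonal entries `b 1, b 2, …` (the values `a 0`, `b 0` are never used): it is a compactly supported
probability measure on the line whose orthonormal polynomials satisfy
`x p n = a (n+1) p (n+1) + b (n+1) p n + a n p (n-1)`, where `p (-1) = 0`. -/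
structure HasJacobiParameters (μ : Measure ℝ) (a b : ℕ → ℝ) : Prop where
  isProbabilityMeasure : IsProbabilityMeasure μ
  compact_support : ∃ K : Set ℝ, IsCompact K ∧ μ Kᶜ = 0
  a_pos : ∀ n, 0 < a (n + 1)
  exists_polynomials : ∃ p : ℕ → Polynomial ℝ, IsOrthonormalPolynomials μ p ∧
    Polynomial.X * p 0 = Polynomial.C (a 1) * p 1 + Polynomial.C (b 1) * p 0 ∧
    ∀ n, Polynomial.X * p (n + 1) = Polynomial.C (a (n + 2)) * p (n + 2)
      + Polynomial.C (b (n + 2)) * p (n + 1) + Polynomial.C (a (n + 1)) * p n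

/-- `c 0, c 1, …` are the Taylor coefficients at `z = 0` of `cosh⁻¹ (1 + z / 2) / √z`, with the
expansion valid for `0 < z < 4`. (Such a sequence is unique, being the coefficient sequence of a
power series with prescribed sum on an interval `(0, 4)`.) -/
def IsArcoshTaylorCoeff (c : ℕ → ℝ) : Prop :=
  ∀ z ∈ Ioo (0 : ℝ) 4, HasSum (fun l : ℕ => c l * z ^ l) (Real.arcosh (1 + z / 2) / √z)

/-- On `(-2, 2)` the measure `μ` is `exp (-2 Q(x)) dx` with `Q` continuous there (this
determines `Q` on `(-2, 2)`). -/
def HasExponentOnInterval (μ : Measure ℝ) (Q : ℝ → ℝ) : Prop :=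
  ContinuousOn Q (Ioo (-2) 2) ∧
    μ.restrict (Ioo (-2) 2) =
      (volume.restrict (Ioo (-2) 2)).withDensity fun x => ENNReal.ofReal (Real.exp (-2 * Q x))

/-- The coefficient `β⁻¹ C^(1/β) Γ(l + 3/2) Γ(1/β - 1/2 - l) / Γ(1/β + 1)`. -/
noncomputable def gammaCoeff (C β : ℝ) (l : ℕ) : ℝ :=
  β⁻¹ * C ^ (1 / β) *
    (Real.Gamma (l + 3 / 2) * Real.Gamma (1 / β - 1 / 2 - l) / Real.Gamma (1 / β + 1))

/-! Write p_n for `jacobiSeq` and T_n for `turan`. Since b increases to 0, for x in (-2, 2) the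
quotient T_n / (2 - x + b_{n+2}) is decreasing once its denominator is positive, and T_n / (2 + x -
b_{n+2}) is increasing (`turan_div_le`, `div_turan_le`). So T_n has a positive limit L, and a single
T_m bounds L on both sides. On the other hand T_n dμ tends weakly to the semicircle law, because far
out the Jacobi matrix looks free (`tendsto_integral_mul_turan`). Comparing the two limits gives L dμ
= √(4 - x²) / (2π) dx on (-2, 2), hence Q = ½ log L + O(log δ).

It remains to estimate log L at x = 2 - δ. For k ≤ N = ⌊(C/δ)^(1/β)⌋ one has x - b_k = 2 cosh γ_k
with γ_k ≥ 0 decreasing, and p_N lies between exp(∑ γ_k) and (N + 1) exp(∑ γ_k). Just past this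
region T_N determines L up to factors polynomial in N, so ½ log L = ∑ γ_k + O(log δ)
(`exists_abs_log_turanLim_sub_le`). Finally γ_k = arcosh(1 + z/2) with z = C k^(-β) - δ is expanded
as ∑ c_l z^(l + 1/2). The sums over k with l < 1/β - 1/2 agree up to O(1) with Beta integrals, which
give the Gamma quotients; the Taylor remainder is O(1/k) and sums to O(log N). -/

/-! ### Recurrence and Turán determinants. -/

/-- The values at `x` of the orthonormal polynomials of the Jacobi matrix with off-diagonal entries
`1` and diagonal entries `b 1, b 2, …`. -/
def jacobiSeq (b : ℕ → ℝ) (x : ℝ) : ℕ → ℝ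
  | 0 => 1
  | 1 => x - b 1
  | n + 2 => (x - b (n + 2)) * jacobiSeq b x (n + 1) - jacobiSeq b x n

/-- The Turán determinant of `jacobiSeq`, a quadratic form in two consecutive values. -/
def turan (b : ℕ → ℝ) (x : ℝ) (n : ℕ) : ℝ :=
  jacobiSeq b x (n + 1) ^ 2 - (x - b (n + 2)) * jacobiSeq b x (n + 1) * jacobiSeq b x n
    + jacobiSeq b x n ^ 2

lemma jacobiSeq_succ_succ (b : ℕ → ℝ) (x : ℝ) (n : ℕ) :
    jacobiSeq b x (n + 2) = (x - b (n + 2)) * jacobiSeq b x (n + 1) - jacobiSeq b x n := rfl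

lemma turan_eq_next (b : ℕ → ℝ) (x : ℝ) (n : ℕ) :
    turan b x n = jacobiSeq b x (n + 2) ^ 2
      - (x - b (n + 2)) * jacobiSeq b x (n + 2) * jacobiSeq b x (n + 1)
      + jacobiSeq b x (n + 1) ^ 2 := by
  rw [turan, jacobiSeq_succ_succ]; ring

lemma turan_succ (b : ℕ → ℝ) (x : ℝ) (n : ℕ) :
    turan b x (n + 1) = turan b x n
      - (b (n + 2) - b (n + 3)) * (jacobiSeq b x (n + 2) * jacobiSeq b x (n + 1)) := by
  rw [turan_eq_next b x n, turan]; ring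

lemma jacobiSeq_ne_zero_or (b : ℕ → ℝ) (x : ℝ) (n : ℕ) :
    jacobiSeq b x n ≠ 0 ∨ jacobiSeq b x (n + 1) ≠ 0 := by
  induction n with
  | zero => left; simp [jacobiSeq]
  | succ n ih =>
    by_contra! h
    have h2 := jacobiSeq_succ_succ b x n
    rw [h.1, h.2] at h2
    rcases ih with ih | ih
    · apply ih; linarith
    · exact ih h.1

lemma continuous_jacobiSeq (b : ℕ → ℝ) (n : ℕ) : Continuous fun x => jacobiSeq b x n := by
  induction n using Nat.strong_induction_on with
  | _ n ih =>
    match n with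
    | 0 => simpa [jacobiSeq] using continuous_const
    | 1 => simp only [jacobiSeq]; fun_prop
    | n + 2 =>
      have h1 := ih (n + 1) (by omega)
      have h0 := ih n (by omega)
      simp only [jacobiSeq_succ_succ]; fun_prop

lemma continuous_turan (b : ℕ → ℝ) (n : ℕ) : Continuous fun x => turan b x n := by
  have h1 := continuous_jacobiSeq b (n + 1)
  have h0 := continuous_jacobiSeq b n
  unfold turan; fun_prop

/-! ### Monotone convergence of the Turán determinants on (-2, 2). -/

section Limit

variable {b : ℕ → ℝ} {x : ℝ}

/-- With u, v the values at n + 2 and n + 1, one step reduces, after cross-multiplying, to T_n - (2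
- x + b_{n+2}) u v = (u - v)² ≥ 0. -/
lemma turan_div_le (hb : MonotoneOn b (Ici 1)) {m n : ℕ} (hm : 0 < 2 - x + b (m + 2))
    (hmn : m ≤ n) :
    turan b x n / (2 - x + b (n + 2)) ≤ turan b x m / (2 - x + b (m + 2)) := by
  induction n, hmn using Nat.le_induction with
  | base => rfl
  | succ n hmn ih =>
    refine le_trans ?_ ih
    have h1 : b (m + 2) ≤ b (n + 2) := hb (by simp) (by simp) (by omega)
    have h2 : b (n + 2) ≤ b (n + 3) := hb (by simp) (by simp) (by omega)
    rw [div_le_div_iff₀ (by show 0 < 2 - x + b (n + 3); linarith) (by linarith), turan_succ,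
      turan_eq_next]
    show _ ≤ _ * (2 - x + b (n + 3))
    nlinarith [mul_nonneg (sub_nonneg.2 h2)
      (sq_nonneg (jacobiSeq b x (n + 2) - jacobiSeq b x (n + 1)))]

/-- The mirror image, resting on T_n + (2 + x - b_{n+2}) u v = (u + v)² ≥ 0. It holds from every
index on, since here the denominator is always positive. -/
lemma div_turan_le (hb : MonotoneOn b (Ici 1)) (hb0 : ∀ n, b (n + 1) ≤ 0) (hx : -2 < x) {m n : ℕ}
    (hmn : m ≤ n) :
    turan b x m / (2 + x - b (m + 2)) ≤ turan b x n / (2 + x - b (n + 2)) := by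
  induction n, hmn using Nat.le_induction with
  | base => rfl
  | succ n hmn ih =>
    refine le_trans ih ?_
    have h2 : b (n + 2) ≤ b (n + 3) := hb (by simp) (by simp) (by omega)
    have h3 : b (n + 3) ≤ 0 := hb0 _
    rw [div_le_div_iff₀ (by linarith) (by show 0 < 2 + x - b (n + 3); linarith), turan_succ,
      turan_eq_next]
    show _ * (2 + x - b (n + 3)) ≤ _
    nlinarith [mul_nonneg (sub_nonneg.2 h2)
      (sq_nonneg (jacobiSeq b x (n + 2) + jacobiSeq b x (n + 1)))]

/-- Diagonalised in the sum and difference of consecutive values, the form has two positive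
coefficients, and consecutive values never vanish together. -/
lemma turan_pos (hb0 : ∀ n, b (n + 1) ≤ 0) (hx : -2 < x) {n : ℕ}
    (hn : 0 < 2 - x + b (n + 2)) : 0 < turan b x n := by
  have h3 : b (n + 2) ≤ 0 := hb0 _
  have key : turan b x n = (2 + x - b (n + 2)) / 4 *
      (jacobiSeq b x (n + 1) - jacobiSeq b x n) ^ 2 + (2 - x + b (n + 2)) / 4 *
      (jacobiSeq b x (n + 1) + jacobiSeq b x n) ^ 2 := by
    rw [turan]; ring
  rw [key]
  have h4 : 0 < 2 + x - b (n + 2) := by linarith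
  by_contra! h
  have e1 : (jacobiSeq b x (n + 1) - jacobiSeq b x n) ^ 2 = 0 := by
    by_contra hne
    have := lt_of_le_of_ne (sq_nonneg (jacobiSeq b x (n + 1) - jacobiSeq b x n)) (Ne.symm hne)
    have : 0 < (2 + x - b (n + 2)) / 4 * (jacobiSeq b x (n + 1) - jacobiSeq b x n) ^ 2 := by
      positivity
    have : 0 ≤ (2 - x + b (n + 2)) / 4 * (jacobiSeq b x (n + 1) + jacobiSeq b x n) ^ 2 := by
      positivity
    linarith
  have e2 : (jacobiSeq b x (n + 1) + jacobiSeq b x n) ^ 2 = 0 := by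
    by_contra hne
    have := lt_of_le_of_ne (sq_nonneg (jacobiSeq b x (n + 1) + jacobiSeq b x n)) (Ne.symm hne)
    have : 0 < (2 - x + b (n + 2)) / 4 * (jacobiSeq b x (n + 1) + jacobiSeq b x n) ^ 2 := by
      positivity
    have : 0 ≤ (2 + x - b (n + 2)) / 4 * (jacobiSeq b x (n + 1) - jacobiSeq b x n) ^ 2 := by
      positivity
    linarith
  have e1' := pow_eq_zero_iff (two_ne_zero) |>.1 e1
  have e2' := pow_eq_zero_iff (two_ne_zero) |>.1 e2
  rcases jacobiSeq_ne_zero_or b x n with h | h <;> apply h <;> linarith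

/-- The limit of the Turán determinants. -/
noncomputable def turanLim (b : ℕ → ℝ) (x : ℝ) : ℝ := limUnder atTop (turan b x)

lemma eventually_pos_shift (hlim : Tendsto b atTop (𝓝 0)) (hx : x < 2) :
    ∀ᶠ n in atTop, 0 < 2 - x + b (n + 2) := by
  have h : Tendsto (fun n => 2 - x + b (n + 2)) atTop (𝓝 (2 - x + 0)) :=
    tendsto_const_nhds.add ((tendsto_add_atTop_iff_nat 2).2 hlim)
  exact h.eventually_const_lt (by linarith)

lemma tendsto_turan (hb : MonotoneOn b (Ici 1)) (hb0 : ∀ n, b (n + 1) ≤ 0)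
    (hlim : Tendsto b atTop (𝓝 0)) (hx : x ∈ Ioo (-2 : ℝ) 2) :
    Tendsto (turan b x) atTop (𝓝 (turanLim b x)) := by
  apply tendsto_nhds_limUnder
  obtain ⟨m, hm⟩ := (eventually_pos_shift hlim hx.2).exists
  have hpos : ∀ k, 0 < 2 - x + b (k + m + 2) := fun k => by
    have : b (m + 2) ≤ b (k + m + 2) := hb (by simp) (by simp) (by omega)
    linarith
  set g : ℕ → ℝ := fun k => turan b x (k + m) / (2 - x + b (k + m + 2)) with hg
  have hanti : Antitone g := antitone_nat_of_succ_le fun k =>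
    turan_div_le hb (hpos k) (by omega)
  have hbdd : BddBelow (range g) := by
    refine ⟨0, ?_⟩
    rintro _ ⟨k, rfl⟩
    exact div_nonneg (turan_pos hb0 hx.1 (hpos k)).le (hpos k).le
  have h1 := tendsto_atTop_ciInf hanti hbdd
  have h2 : Tendsto (fun k => 2 - x + b (k + m + 2)) atTop (𝓝 (2 - x + 0)) :=
    tendsto_const_nhds.add ((tendsto_add_atTop_iff_nat (m + 2)).2 hlim)
  refine ⟨_, (tendsto_add_atTop_iff_nat m).1 ((h1.mul h2).congr fun k => ?_)⟩
  rw [hg]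
  exact div_mul_cancel₀ _ (hpos k).ne'

lemma turanLim_div_le (hb : MonotoneOn b (Ici 1)) (hb0 : ∀ n, b (n + 1) ≤ 0)
    (hlim : Tendsto b atTop (𝓝 0)) (hx : x ∈ Ioo (-2 : ℝ) 2) {m : ℕ}
    (hm : 0 < 2 - x + b (m + 2)) :
    turanLim b x / (2 - x) ≤ turan b x m / (2 - x + b (m + 2)) := by
  have h2 : Tendsto (fun k => 2 - x + b (k + 2)) atTop (𝓝 (2 - x + 0)) :=
    tendsto_const_nhds.add ((tendsto_add_atTop_iff_nat 2).2 hlim)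
  rw [add_zero] at h2
  exact le_of_tendsto ((tendsto_turan hb hb0 hlim hx).div h2 (by linarith [hx.2]))
    (eventually_atTop.2 ⟨m, fun n hn => turan_div_le hb hm hn⟩)

lemma div_turanLim_le (hb : MonotoneOn b (Ici 1)) (hb0 : ∀ n, b (n + 1) ≤ 0)
    (hlim : Tendsto b atTop (𝓝 0)) (hx : x ∈ Ioo (-2 : ℝ) 2) (m : ℕ) :
    turan b x m / (2 + x - b (m + 2)) ≤ turanLim b x / (2 + x) := by
  have h2 : Tendsto (fun k => 2 + x - b (k + 2)) atTop (𝓝 (2 + x - 0)) :=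
    tendsto_const_nhds.sub ((tendsto_add_atTop_iff_nat 2).2 hlim)
  rw [sub_zero] at h2
  exact ge_of_tendsto ((tendsto_turan hb hb0 hlim hx).div h2 (by linarith [hx.1]))
    (eventually_atTop.2 ⟨m, fun n hn => div_turan_le hb hb0 hx.1 hn⟩)

lemma turanLim_pos (hb : MonotoneOn b (Ici 1)) (hb0 : ∀ n, b (n + 1) ≤ 0)
    (hlim : Tendsto b atTop (𝓝 0)) (hx : x ∈ Ioo (-2 : ℝ) 2) : 0 < turanLim b x := by
  obtain ⟨m, hm⟩ := (eventually_pos_shift hlim hx.2).exists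
  have h3 : b (m + 2) ≤ 0 := hb0 _
  have h1 : 0 < turan b x m / (2 + x - b (m + 2)) :=
    div_pos (turan_pos hb0 hx.1 hm) (by linarith [hx.1])
  have h2 := h1.trans_le (div_turanLim_le hb hb0 hlim hx m)
  have h4 : 0 < 2 + x := by linarith [hx.1]
  exact (div_pos_iff_of_pos_right h4).1 h2

/-- L / (2 + x) is a supremum of continuous functions and L / (2 - x) is locally an infimum of such;
this gives lower and upper semicontinuity respectively. -/
lemma continuousOn_turanLim (hb : MonotoneOn b (Ici 1)) (hb0 : ∀ n, b (n + 1) ≤ 0)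
    (hlim : Tendsto b atTop (𝓝 0)) : ContinuousOn (turanLim b) (Ioo (-2) 2) := by
  intro x hx
  refine ContinuousAt.continuousWithinAt ?_
  have hmem : ∀ᶠ y in 𝓝 x, y ∈ Ioo (-2 : ℝ) 2 := Ioo_mem_nhds hx.1 hx.2
  have hT := tendsto_turan hb hb0 hlim hx
  have hbs := (tendsto_add_atTop_iff_nat 2).2 hlim
  refine tendsto_order.2 ⟨fun a ha => ?_, fun a ha => ?_⟩
  · have h2 : Tendsto (fun k => 2 + x - b (k + 2)) atTop (𝓝 (2 + x - 0)) :=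
      tendsto_const_nhds.sub hbs
    have h3 := (hT.div h2 (by linarith [hx.1])).mul_const (2 + x)
    rw [sub_zero, div_mul_cancel₀ _ (by linarith [hx.1])] at h3
    obtain ⟨m, hm⟩ := (h3.eventually_const_lt ha).exists
    have h0 : b (m + 2) ≤ 0 := hb0 _
    have hc : ContinuousAt (fun y => turan b y m / (2 + y - b (m + 2)) * (2 + y)) x :=
      (((continuous_turan b m).continuousAt).div
        (by fun_prop : ContinuousAt (fun y => 2 + y - b (m + 2)) x) (by linarith [hx.1])).mul
        (by fun_prop : ContinuousAt (fun y => 2 + y) x)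
    filter_upwards [hmem, hc.eventually_const_lt hm] with y hy hy2
    have h5 := div_turanLim_le hb hb0 hlim hy m
    rw [le_div_iff₀ (by linarith [hy.1])] at h5
    linarith
  · have h2 : Tendsto (fun k => 2 - x + b (k + 2)) atTop (𝓝 (2 - x + 0)) :=
      tendsto_const_nhds.add hbs
    have h3 := (hT.div h2 (by linarith [hx.2])).mul_const (2 - x)
    rw [add_zero, div_mul_cancel₀ _ (by linarith [hx.2])] at h3
    obtain ⟨m, hm, hpos⟩ :=
      ((h3.eventually_lt_const ha).and (eventually_pos_shift hlim hx.2)).exists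
    have hc : ContinuousAt (fun y => turan b y m / (2 - y + b (m + 2)) * (2 - y)) x :=
      (((continuous_turan b m).continuousAt).div
        (by fun_prop : ContinuousAt (fun y => 2 - y + b (m + 2)) x) hpos.ne').mul
        (by fun_prop : ContinuousAt (fun y => 2 - y) x)
    have hc2 : ContinuousAt (fun y => 2 - y + b (m + 2)) x := by fun_prop
    filter_upwards [hmem, hc.eventually_lt_const hm, hc2.eventually_const_lt hpos]
      with y hy hy2 hy3
    have h5 := turanLim_div_le hb hb0 hlim hy hy3
    rw [div_le_iff₀ (by linarith [hy.2])] at h5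
    linarith

end Limit

/-! ### Growth of the polynomials where x - b_k ≥ 2. -/

section Forbidden

variable {b γ : ℕ → ℝ} {x : ℝ} {N : ℕ}

/-- In the classically forbidden region, the lower bound for the growth. -/
lemma jacobiSeq_lower (hγ : ∀ k ∈ Icc 1 N, 0 ≤ γ k ∧ 2 * Real.cosh (γ k) = x - b k)
    (hanti : AntitoneOn γ (Icc 1 N)) {n : ℕ} (hn : n + 1 ≤ N) :
    0 < jacobiSeq b x n ∧ Real.exp (γ (n + 1)) * jacobiSeq b x n ≤ jacobiSeq b x (n + 1) := by
  have hcosh : ∀ k ∈ Icc 1 N, x - b k = Real.exp (γ k) + Real.exp (-γ k) := fun k hk => by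
    rw [← (hγ k hk).2, Real.cosh_eq]; ring
  induction n with
  | zero =>
    have := hcosh 1 ⟨le_rfl, hn⟩
    have h2 := Real.exp_pos (-γ 1)
    simp only [jacobiSeq, zero_add, this]
    constructor <;> linarith
  | succ n ih =>
    obtain ⟨h0, h1⟩ := ih (by omega)
    have hp : 0 < jacobiSeq b x (n + 1) := lt_of_lt_of_le (by positivity) h1
    refine ⟨hp, ?_⟩
    show _ ≤ jacobiSeq b x (n + 2)
    rw [jacobiSeq_succ_succ, hcosh (n + 2) ⟨by omega, hn⟩]
    -- As γ decreases, the previous growth bound gives p_n ≤ e^(-γ_{n+2}) p_{n+1}, so subtracting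
    -- p_n costs at most the decaying half of 2 cosh γ_{n+2}.
    have hle : γ (n + 2) ≤ γ (n + 1) := hanti ⟨by omega, by omega⟩ ⟨by omega, hn⟩ (by omega)
    have h3 : Real.exp (γ (n + 2)) * jacobiSeq b x n ≤ jacobiSeq b x (n + 1) :=
      le_trans (by gcongr) h1
    have h4 : jacobiSeq b x n ≤ Real.exp (-γ (n + 2)) * jacobiSeq b x (n + 1) := by
      calc jacobiSeq b x n
          = Real.exp (-γ (n + 2)) * (Real.exp (γ (n + 2)) * jacobiSeq b x n) := by
            rw [← mul_assoc, ← Real.exp_add]; simp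
        _ ≤ _ := by gcongr
    show Real.exp (γ (n + 2)) * _ ≤ _
    linarith

lemma exp_sum_le_jacobiSeq (hγ : ∀ k ∈ Icc 1 N, 0 ≤ γ k ∧ 2 * Real.cosh (γ k) = x - b k)
    (hanti : AntitoneOn γ (Icc 1 N)) {n : ℕ} (hn : n ≤ N) :
    Real.exp (∑ k ∈ Finset.range n, γ (k + 1)) ≤ jacobiSeq b x n := by
  induction n with
  | zero => simp [jacobiSeq]
  | succ n ih =>
    rw [Finset.sum_range_succ, Real.exp_add, mul_comm]
    exact le_trans (by gcongr; exact ih (by omega)) (jacobiSeq_lower hγ hanti hn).2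

/-- The recurrence factors as p_{n+2} - e^(-γ) p_{n+1} = e^γ (p_{n+1} - e^(-γ) p_n) with γ =
γ_{n+2}. Replacing γ by the larger γ_{n+1} inside the bracket only increases it. -/
lemma jacobiSeq_sub_le (hγ : ∀ k ∈ Icc 1 N, 0 ≤ γ k ∧ 2 * Real.cosh (γ k) = x - b k)
    (hanti : AntitoneOn γ (Icc 1 N)) {n : ℕ} (hn : n + 1 ≤ N) :
    jacobiSeq b x (n + 1) - Real.exp (-γ (n + 1)) * jacobiSeq b x n
      ≤ Real.exp (∑ k ∈ Finset.range (n + 1), γ (k + 1)) := by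
  have hcosh : ∀ k ∈ Icc 1 N, x - b k = Real.exp (γ k) + Real.exp (-γ k) := fun k hk => by
    rw [← (hγ k hk).2, Real.cosh_eq]; ring
  induction n with
  | zero =>
    have := hcosh 1 ⟨le_rfl, hn⟩
    simp [jacobiSeq, this]
  | succ n ih =>
    have hle : γ (n + 2) ≤ γ (n + 1) := hanti ⟨by omega, by omega⟩ ⟨by omega, hn⟩ (by omega)
    have hp := (jacobiSeq_lower hγ hanti (n := n) (by omega)).1
    rw [Finset.sum_range_succ, Real.exp_add]
    show jacobiSeq b x (n + 2) - Real.exp (-γ (n + 2)) * jacobiSeq b x (n + 1) ≤ _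
    rw [jacobiSeq_succ_succ, hcosh (n + 2) ⟨by omega, hn⟩]
    have h1 : Real.exp (-γ (n + 1)) * jacobiSeq b x n
        ≤ Real.exp (-γ (n + 2)) * jacobiSeq b x n := by gcongr
    have h2 : Real.exp (γ (n + 2)) * (jacobiSeq b x (n + 1)
        - Real.exp (-γ (n + 2)) * jacobiSeq b x n)
        ≤ Real.exp (γ (n + 2)) * Real.exp (∑ k ∈ Finset.range (n + 1), γ (k + 1)) := by
      gcongr
      linarith [ih (by omega)]
    have h3 : Real.exp (γ (n + 2)) * Real.exp (-γ (n + 2)) = 1 := by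
      rw [← Real.exp_add]; simp
    have h4 : Real.exp (γ (n + 2)) * (Real.exp (-γ (n + 2)) * jacobiSeq b x n)
        = jacobiSeq b x n := by rw [← mul_assoc, h3, one_mul]
    rw [mul_sub, h4] at h2
    show _ ≤ _ * Real.exp (γ (n + 2))
    linarith

/-- By the preceding bound each step adds at most one exponential. The resulting factor n + 1
matters only logarithmically. -/
lemma jacobiSeq_le_mul_exp_sum (hγ : ∀ k ∈ Icc 1 N, 0 ≤ γ k ∧ 2 * Real.cosh (γ k) = x - b k)
    (hanti : AntitoneOn γ (Icc 1 N)) {n : ℕ} (hn : n ≤ N) :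
    jacobiSeq b x n ≤ (n + 1) * Real.exp (∑ k ∈ Finset.range n, γ (k + 1)) := by
  induction n with
  | zero => simp [jacobiSeq]
  | succ n ih =>
    have h1 := jacobiSeq_sub_le hγ hanti hn
    have h0 := (hγ (n + 1) ⟨by omega, hn⟩).1
    have hp := (jacobiSeq_lower hγ hanti hn).1
    have h2 : Real.exp (-γ (n + 1)) * jacobiSeq b x n ≤ 1 * jacobiSeq b x n := by
      gcongr; exact Real.exp_le_one_iff.2 (by linarith)
    have h3 : Real.exp (∑ k ∈ Finset.range n, γ (k + 1))
        ≤ Real.exp (∑ k ∈ Finset.range (n + 1), γ (k + 1)) := by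
      rw [Finset.sum_range_succ]; gcongr; linarith
    have h4 := ih (by omega)
    push_cast
    have h5 : ((n : ℝ) + 1) * Real.exp (∑ k ∈ Finset.range n, γ (k + 1))
        ≤ (n + 1) * Real.exp (∑ k ∈ Finset.range (n + 1), γ (k + 1)) := by gcongr
    linarith

end Forbidden

/-! ### Weak convergence of T_n dμ to the semicircle law. -/

section Moments

variable {μ : Measure ℝ} {b : ℕ → ℝ} {R : ℝ}

lemma HasJacobiParameters.integral_jacobiSeq (h : HasJacobiParameters μ (fun _ => 1) b) (m n : ℕ) :
    ∫ x, jacobiSeq b x m * jacobiSeq b x n ∂μ = if m = n then 1 else 0 := by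
  obtain ⟨p, hp, h0, h1⟩ := h.exists_polynomials
  have := h.isProbabilityMeasure
  -- Normalisation leaves ±1, and the leading coefficient selects the sign.
  have hp0 : p 0 = 1 := by
    have e := Polynomial.eq_C_of_natDegree_eq_zero (hp.natDegree_eq 0)
    have hpos := hp.leadingCoeff_pos 0
    have ho := hp.orthonormal 0 0
    rw [e] at hpos ho ⊢
    simp only [Polynomial.leadingCoeff_C, Polynomial.eval_C, integral_const, probReal_univ,
      if_true, smul_eq_mul, one_mul] at hpos ho
    have : (p 0).coeff 0 = 1 := by nlinarith
    rw [this, Polynomial.C_1]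
  have key : ∀ k x, (p k).eval x = jacobiSeq b x k := by
    intro k x
    induction k using Nat.strong_induction_on with
    | _ k ih =>
      match k with
      | 0 => simp [hp0, jacobiSeq]
      | 1 =>
        have := congrArg (Polynomial.eval x) h0
        simp only [hp0, Polynomial.eval_mul, Polynomial.eval_add, Polynomial.eval_X,
          Polynomial.eval_C, Polynomial.eval_one] at this
        simp only [jacobiSeq]; linarith
      | k + 2 =>
        have := congrArg (Polynomial.eval x) (h1 k)
        simp only [Polynomial.eval_mul, Polynomial.eval_add, Polynomial.eval_X,
          Polynomial.eval_C, ih k (by omega), ih (k + 1) (by omega)] at this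
        rw [jacobiSeq_succ_succ]; linarith
  simpa only [key] using hp.orthonormal m n

lemma HasJacobiParameters.exists_bound {a : ℕ → ℝ} (h : HasJacobiParameters μ a b) :
    ∃ R : ℝ, 2 ≤ R ∧ ∀ᵐ x ∂μ, x ∈ Icc (-R) R := by
  obtain ⟨K, hK, hμ⟩ := h.compact_support
  obtain ⟨R, hR⟩ := hK.isBounded.subset_closedBall 0
  refine ⟨max R 2, le_max_right _ _, ?_⟩
  have : ∀ᵐ x ∂μ, x ∈ K := by rwa [ae_iff]
  filter_upwards [this] with x hx
  have := hR hx
  rw [mem_closedBall_zero_iff, Real.norm_eq_abs] at this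
  exact abs_le.1 (this.trans (le_max_left _ _))

lemma integrable_of_continuous [IsFiniteMeasure μ] (hR : ∀ᵐ x ∂μ, x ∈ Icc (-R) R) {f : ℝ → ℝ}
    (hf : Continuous f) : Integrable f μ := by
  obtain ⟨K, hK⟩ := isCompact_Icc.exists_bound_of_continuousOn (s := Icc (-R) R) hf.continuousOn
  exact Integrable.of_bound hf.aestronglyMeasurable K (hR.mono fun x hx => hK x hx)

/-- The moments of the whole-line free Jacobi matrix between the sites `i` and `j`. -/
noncomputable def freeMoment (k : ℕ) (i j : ℕ) : ℝ :=
  (1 / Real.pi) * ∫ θ in (0 : ℝ)..Real.pi, (2 * Real.cos θ) ^ k * Real.cos ((i - j : ℝ) * θ)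

lemma freeMoment_zero (i j : ℕ) : freeMoment 0 i j = if i = j then 1 else 0 := by
  unfold freeMoment
  split_ifs with hij
  · subst hij; simp [Real.pi_ne_zero]
  · have hne : (i - j : ℝ) ≠ 0 := sub_ne_zero.2 (by exact_mod_cast hij)
    simp only [pow_zero, one_mul]
    rw [intervalIntegral.integral_comp_mul_left (fun y => Real.cos y) hne, integral_cos]
    have : Real.sin ((i - j : ℝ) * Real.pi) = 0 := by
      have := Real.sin_int_mul_pi ((i : ℤ) - j)
      push_cast at this; exact this
    simp [this]

lemma freeMoment_succ (k i j : ℕ) :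
    freeMoment (k + 1) i (j + 1) = freeMoment k i (j + 2) + freeMoment k i j := by
  unfold freeMoment
  rw [← mul_add, ← intervalIntegral.integral_add
    (Continuous.intervalIntegrable (by fun_prop) _ _)
    (Continuous.intervalIntegrable (by fun_prop) _ _)]
  congr 2
  ext θ
  have e1 : ((i : ℝ) - ↑(j + 2)) * θ = ((i : ℝ) - ↑(j + 1)) * θ - θ := by push_cast; ring
  have e2 : ((i : ℝ) - ↑j) * θ = ((i : ℝ) - ↑(j + 1)) * θ + θ := by push_cast; ring
  rw [e1, e2, Real.cos_sub, Real.cos_add]; ring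

lemma freeMoment_shift (k i j : ℕ) : freeMoment k (i + 1) (j + 1) = freeMoment k i j := by
  unfold freeMoment; push_cast; simp

/-- One factor x is absorbed by the recurrence at the second index; the diagonal term carries a
factor b tending to 0, so the limits satisfy the free recurrence `freeMoment_succ`. -/
lemma tendsto_moment (h : HasJacobiParameters μ (fun _ => 1) b) (hlim : Tendsto b atTop (𝓝 0))
    (k i j : ℕ) :
    Tendsto (fun n => ∫ x, x ^ k * (jacobiSeq b x (n + i) * jacobiSeq b x (n + j)) ∂μ) atTop
      (𝓝 (freeMoment k i j)) := by
  have := h.isProbabilityMeasure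
  obtain ⟨R, -, hR⟩ := h.exists_bound
  have hc := continuous_jacobiSeq b
  induction k generalizing i j with
  | zero =>
    simp only [pow_zero, one_mul, h.integral_jacobiSeq, freeMoment_zero, add_right_inj]
    exact tendsto_const_nhds
  | succ k ih =>
    have step : ∀ i j, Tendsto (fun n => ∫ x, x ^ (k + 1) *
        (jacobiSeq b x (n + i) * jacobiSeq b x (n + (j + 1))) ∂μ) atTop
        (𝓝 (freeMoment (k + 1) i (j + 1))) := by
      intro i j
      have hb := (tendsto_add_atTop_iff_nat (j + 2)).2 hlim
      have h1 := ((ih i (j + 2)).add (hb.mul (ih i (j + 1)))).add (ih i j)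
      rw [zero_mul, add_zero, ← freeMoment_succ] at h1
      refine h1.congr fun n => ?_
      have c0 := hc (n + i)
      have c1 := hc (n + j)
      have c2 := hc (n + (j + 1))
      have c3 := hc (n + (j + 2))
      rw [← integral_const_mul, ← integral_add (integrable_of_continuous hR (by fun_prop))
        (integrable_of_continuous hR (by fun_prop)),
        ← integral_add (integrable_of_continuous hR (by fun_prop))
        (integrable_of_continuous hR (by fun_prop))]
      refine integral_congr_ae (Eventually.of_forall fun x => ?_)
      have := jacobiSeq_succ_succ b x (n + j)
      have e : n + (j + 2) = n + j + 2 := by ring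
      have e' : n + (j + 1) = n + j + 1 := by ring
      simp only [e, e', this]; ring
    cases j with
    | succ j => exact step i j
    | zero =>
      have := (tendsto_add_atTop_iff_nat 1).2 (ih 0 0)
      -- For j = 0 the recurrence would reach site n - 1; shifting n by one reduces to the case j =
      -- 1.
      rw [← freeMoment_shift]
      refine (tendsto_add_atTop_iff_nat 1).1 ?_
      refine ((tendsto_add_atTop_iff_nat 0).2 (step (i + 1) 0)).congr fun n => ?_
      have e : n + 1 + i = n + (i + 1) := by ring
      simp [e]

/-- The semicircle functional, in the coordinate `x = 2 cos θ`. -/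
noncomputable def semicircle (f : ℝ → ℝ) : ℝ :=
  (1 / Real.pi) * ∫ θ in (0 : ℝ)..Real.pi, f (2 * Real.cos θ) * (2 * Real.sin θ ^ 2)

/-- The Turán form with b = 0 produces the weight 1 - 2 cos²θ + 1 = 2 sin²θ. -/
lemma semicircle_pow (k : ℕ) : semicircle (fun x => x ^ k)
    = freeMoment k 1 1 - freeMoment (k + 1) 1 0 + freeMoment k 0 0 := by
  unfold semicircle freeMoment
  rw [← mul_sub, ← mul_add, ← intervalIntegral.integral_sub
    (Continuous.intervalIntegrable (by fun_prop) _ _)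
    (Continuous.intervalIntegrable (by fun_prop) _ _), ← intervalIntegral.integral_add
    (Continuous.intervalIntegrable (by fun_prop) _ _)
    (Continuous.intervalIntegrable (by fun_prop) _ _)]
  congr 2
  ext θ
  simp [Real.sin_sq]; ring

lemma tendsto_integral_pow_mul_turan (h : HasJacobiParameters μ (fun _ => 1) b)
    (hlim : Tendsto b atTop (𝓝 0)) (k : ℕ) :
    Tendsto (fun n => ∫ x, x ^ k * turan b x n ∂μ) atTop (𝓝 (semicircle fun x => x ^ k)) := by
  have := h.isProbabilityMeasure
  obtain ⟨R, -, hR⟩ := h.exists_bound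
  have hc := continuous_jacobiSeq b
  have hb := (tendsto_add_atTop_iff_nat 2).2 hlim
  have h1 := (((tendsto_moment h hlim k 1 1).sub (tendsto_moment h hlim (k + 1) 1 0)).add
    (hb.mul (tendsto_moment h hlim k 1 0))).add (tendsto_moment h hlim k 0 0)
  rw [zero_mul, add_zero, ← semicircle_pow] at h1
  refine h1.congr fun n => ?_
  have c0 := hc (n + 0)
  have c1 := hc (n + 1)
  rw [← integral_const_mul, ← integral_sub (integrable_of_continuous hR (by fun_prop))
      (integrable_of_continuous hR (by fun_prop)),
    ← integral_add (integrable_of_continuous hR (by fun_prop))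
      (integrable_of_continuous hR (by fun_prop)),
    ← integral_add (integrable_of_continuous hR (by fun_prop))
      (integrable_of_continuous hR (by fun_prop))]
  refine integral_congr_ae (Eventually.of_forall fun x => ?_)
  simp only [turan, add_zero]; ring

lemma tendsto_integral_polynomial_mul_turan (h : HasJacobiParameters μ (fun _ => 1) b)
    (hlim : Tendsto b atTop (𝓝 0)) (P : Polynomial ℝ) :
    Tendsto (fun n => ∫ x, P.eval x * turan b x n ∂μ) atTop (𝓝 (semicircle fun x => P.eval x)) := by
  have := h.isProbabilityMeasure
  obtain ⟨R, -, hR⟩ := h.exists_bound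
  induction P using Polynomial.induction_on' with
  | add P Q hP hQ =>
    have e : semicircle (fun x => (P + Q).eval x)
        = semicircle (fun x => P.eval x) + semicircle (fun x => Q.eval x) := by
      unfold semicircle
      rw [← mul_add, ← intervalIntegral.integral_add
        (Continuous.intervalIntegrable (by fun_prop) _ _)
        (Continuous.intervalIntegrable (by fun_prop) _ _)]
      simp [add_mul]
    rw [e]
    refine (hP.add hQ).congr fun n => ?_
    have ht := continuous_turan b n
    rw [← integral_add (integrable_of_continuous hR (by fun_prop))
      (integrable_of_continuous hR (by fun_prop))]
    simp [add_mul]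
  | monomial k a =>
    have e : semicircle (fun x => (Polynomial.monomial k a).eval x)
        = a * semicircle (fun x => x ^ k) := by
      unfold semicircle
      rw [mul_left_comm, ← intervalIntegral.integral_const_mul]
      simp [mul_assoc]
    rw [e]
    refine ((tendsto_integral_pow_mul_turan h hlim k).const_mul a).congr fun n => ?_
    rw [← integral_const_mul]
    simp [mul_assoc]

/-- The measures T_n dμ may be signed, so Weierstrass approximation needs uniformly bounded total
variation. It follows from 2|uv| ≤ u² + v² and orthonormality. -/
lemma exists_integral_abs_turan_le (h : HasJacobiParameters μ (fun _ => 1) b)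
    (hlim : Tendsto b atTop (𝓝 0)) : ∃ K : ℝ, 0 < K ∧ ∀ n, ∫ x, |turan b x n| ∂μ ≤ K := by
  have := h.isProbabilityMeasure
  obtain ⟨R, hR2, hR⟩ := h.exists_bound
  obtain ⟨B, hB⟩ := hlim.norm.bddAbove_range
  refine ⟨2 + R + |B|, by positivity, fun n => ?_⟩
  have hc := continuous_jacobiSeq b
  have hi : ∀ m, Integrable (fun x => jacobiSeq b x m * jacobiSeq b x m) μ :=
    fun m => integrable_of_continuous hR (by have := hc m; fun_prop)
  have ht := continuous_turan b n
  calc ∫ x, |turan b x n| ∂μ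
      ≤ ∫ x, (1 + (R + |B|) / 2) * (jacobiSeq b x (n + 1) * jacobiSeq b x (n + 1)
          + jacobiSeq b x n * jacobiSeq b x n) ∂μ := by
        refine integral_mono_ae (integrable_of_continuous hR (by fun_prop))
          (((hi _).add (hi _)).const_mul _) ?_
        filter_upwards [hR] with x hx
        have h1 : |x - b (n + 2)| ≤ R + |B| := by
          have h2 : |b (n + 2)| ≤ B := hB ⟨n + 2, rfl⟩
          have := abs_sub x (b (n + 2))
          have := abs_le.2 hx
          have := le_abs_self B
          linarith
        set u := jacobiSeq b x (n + 1)
        set v := jacobiSeq b x n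
        have h3 : |(x - b (n + 2)) * u * v| ≤ (R + |B|) * ((u * u + v * v) / 2) := by
          rw [mul_assoc, abs_mul]
          refine mul_le_mul h1 ?_ (abs_nonneg _) (by positivity)
          rw [abs_le]; constructor <;> nlinarith [sq_nonneg (u - v), sq_nonneg (u + v)]
        have h4 := abs_le.1 h3
        show |u ^ 2 - (x - b (n + 2)) * u * v + v ^ 2| ≤ _
        rw [abs_le]; constructor <;> nlinarith [mul_self_nonneg u, mul_self_nonneg v]
    _ = 2 + R + |B| := by
        rw [integral_const_mul, integral_add (hi _) (hi _), h.integral_jacobiSeq,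
          h.integral_jacobiSeq]
        simp; ring

/-- The measures `turan b x n ∂μ` converge weakly to the semicircle law. -/
lemma tendsto_integral_mul_turan (h : HasJacobiParameters μ (fun _ => 1) b)
    (hlim : Tendsto b atTop (𝓝 0)) {f : ℝ → ℝ} (hf : Continuous f) :
    Tendsto (fun n => ∫ x, f x * turan b x n ∂μ) atTop (𝓝 (semicircle f)) := by
  have := h.isProbabilityMeasure
  obtain ⟨R, hR2, hR⟩ := h.exists_bound
  obtain ⟨K, hK, hKn⟩ := exists_integral_abs_turan_le h hlim
  rw [Metric.tendsto_atTop]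
  intro ε hε
  -- K bounds the total variation of T_n dμ and 2 bounds the semicircle functional, so the two
  -- approximation errors add up to ε/2.
  obtain ⟨P, hP⟩ := exists_polynomial_near_of_continuousOn (-R) R f hf.continuousOn
    (ε / (2 * (K + 2))) (by positivity)
  set η := ε / (2 * (K + 2)) with hη
  have hη0 : 0 < η := by positivity
  have h1 : ∀ n, |∫ x, f x * turan b x n ∂μ - ∫ x, P.eval x * turan b x n ∂μ| ≤ η * K := by
    intro n
    have ht := continuous_turan b n
    rw [← integral_sub (integrable_of_continuous hR (by fun_prop))
      (integrable_of_continuous hR (by fun_prop))]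
    calc |∫ x, (f x * turan b x n - P.eval x * turan b x n) ∂μ|
        ≤ ∫ x, |f x * turan b x n - P.eval x * turan b x n| ∂μ := abs_integral_le_integral_abs
      _ ≤ ∫ x, η * |turan b x n| ∂μ := by
        refine integral_mono_ae (integrable_of_continuous hR (by fun_prop))
          (integrable_of_continuous hR (by fun_prop)) ?_
        filter_upwards [hR] with x hx
        rw [← sub_mul, abs_mul, abs_sub_comm]
        exact mul_le_mul_of_nonneg_right (hP x hx).le (abs_nonneg _)
      _ ≤ η * K := by
        rw [integral_const_mul]; exact mul_le_mul_of_nonneg_left (hKn n) hη0.le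
  have h2 : |semicircle f - semicircle fun x => P.eval x| ≤ η * 2 := by
    unfold semicircle
    rw [← mul_sub, ← intervalIntegral.integral_sub
      (Continuous.intervalIntegrable (by fun_prop) _ _)
      (Continuous.intervalIntegrable (by fun_prop) _ _), abs_mul,
      abs_of_pos (one_div_pos.2 Real.pi_pos)]
    have := intervalIntegral.norm_integral_le_of_norm_le_const (a := 0) (b := Real.pi)
      (C := η * 2) (f := fun θ => f (2 * Real.cos θ) * (2 * Real.sin θ ^ 2)
        - P.eval (2 * Real.cos θ) * (2 * Real.sin θ ^ 2)) (fun θ _ => by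
        rw [← sub_mul, norm_mul, Real.norm_eq_abs, Real.norm_eq_abs, abs_sub_comm]
        have hc1 := Real.neg_one_le_cos θ
        have hc2 := Real.cos_le_one θ
        refine mul_le_mul (hP _ ⟨by linarith, by linarith⟩).le ?_ (abs_nonneg _) hη0.le
        rw [abs_of_nonneg (by positivity)]
        linarith [Real.sin_sq_le_one θ])
    rw [sub_zero, abs_of_pos Real.pi_pos] at this
    calc _ ≤ 1 / Real.pi * (η * 2 * Real.pi) :=
          mul_le_mul_of_nonneg_left this (one_div_pos.2 Real.pi_pos).le
      _ = η * 2 := by field_simp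
  obtain ⟨n0, hn0⟩ := Metric.tendsto_atTop.1 (tendsto_integral_polynomial_mul_turan h hlim P)
    (ε / 2) (by positivity)
  refine ⟨n0, fun n hn => ?_⟩
  have h3 := hn0 n hn
  rw [Real.dist_eq] at h3 ⊢
  have h4 := h1 n
  have h5 : η * K + η * 2 = ε / 2 := by rw [hη]; field_simp
  rw [abs_lt] at h3 ⊢
  rw [abs_le] at h2 h4
  constructor <;> linarith [h2.1, h2.2, h4.1, h4.2, h3.1, h3.2]

lemma semicircle_eq_integral {f : ℝ → ℝ} (hf : Continuous f) :
    semicircle f = ∫ x in Ioo (-2 : ℝ) 2, f x * (√(4 - x ^ 2) / (2 * Real.pi)) := by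
  have hs := intervalIntegral.integral_comp_mul_deriv (a := 0) (b := Real.pi)
    (f := fun θ => 2 * Real.cos θ) (f' := fun θ => 2 * (-Real.sin θ))
    (g := fun x => f x * (√(4 - x ^ 2) / (2 * Real.pi)))
    (fun θ _ => (Real.hasDerivAt_cos θ).const_mul 2) (by fun_prop) (by fun_prop)
  simp only [Real.cos_zero, Real.cos_pi, mul_one, mul_neg] at hs
  rw [intervalIntegral.integral_symm (-2) 2,
    intervalIntegral.integral_of_le (show (-2 : ℝ) ≤ 2 by norm_num),
    integral_Ioc_eq_integral_Ioo] at hs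
  rw [← neg_eq_iff_eq_neg.2 hs, semicircle, ← intervalIntegral.integral_const_mul,
    ← intervalIntegral.integral_neg]
  refine intervalIntegral.integral_congr fun θ hθ => ?_
  rw [uIcc_of_le Real.pi_pos.le] at hθ
  have h1 : √(4 - (2 * Real.cos θ) ^ 2) = 2 * Real.sin θ := by
    rw [← Real.sqrt_sq (mul_nonneg zero_le_two (Real.sin_nonneg_of_mem_Icc hθ))]
    congr 1; nlinarith [Real.sin_sq_add_cos_sq θ]
  simp only [Function.comp, h1]
  field_simp

end Moments

/-! ### Identification of the density on (-2, 2). -/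

section Density

variable {μ : Measure ℝ} {b : ℕ → ℝ}

/-- The density of the spectral measure on `(-2, 2)`. -/
noncomputable def jacobiWeight (b : ℕ → ℝ) (x : ℝ) : ℝ :=
  √(4 - x ^ 2) / (2 * Real.pi) / turanLim b x

/-- Both sides are limits of ∫ f T_n dμ. Monotonicity supplies the dominating function: on the
support of f, T_n ≤ 4 T_m / (c + b_{m+2}) for n ≥ m, where 4 bounds 2 - x + b_{n+2}. -/
lemma integral_mul_turanLim (h : HasJacobiParameters μ (fun _ => 1) b)
    (hb : MonotoneOn b (Ici 1)) (hb0 : ∀ n, b (n + 1) ≤ 0) (hlim : Tendsto b atTop (𝓝 0))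
    {f : ℝ → ℝ} (hf : Continuous f) {c : ℝ} (hc : 0 < c) (hsupp : ∀ x, 2 - c < |x| → f x = 0) :
    ∫ x, f x * turanLim b x ∂μ
      = ∫ x in Ioo (-2 : ℝ) 2, f x * (√(4 - x ^ 2) / (2 * Real.pi)) := by
  have := h.isProbabilityMeasure
  obtain ⟨R, hR2, hR⟩ := h.exists_bound
  rw [← semicircle_eq_integral hf]
  refine tendsto_nhds_unique ?_ (tendsto_integral_mul_turan h hlim hf)
  obtain ⟨m, hm⟩ := (eventually_pos_shift (x := 2 - c) hlim (by linarith)).exists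
  have hcont : Continuous fun x => |f x * (4 * turan b x m)| / (c + b (m + 2)) := by
    have := continuous_turan b m
    fun_prop
  have hpos : 0 < c + b (m + 2) := by linarith
  refine tendsto_integral_filter_of_dominated_convergence _ ?_ ?_
    (integrable_of_continuous hR hcont) ?_
  · refine Eventually.of_forall fun n => Continuous.aestronglyMeasurable ?_
    have := continuous_turan b n
    fun_prop
  · filter_upwards [eventually_ge_atTop m] with n hn
    refine Eventually.of_forall fun x => ?_
    by_cases hx : 2 - c < |x|
    · simp [hsupp x hx]
    · push Not at hx
      have hx' := abs_le.1 hx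
      have e1 : c + b (m + 2) ≤ 2 - x + b (m + 2) := by linarith
      have e2 : b (m + 2) ≤ b (n + 2) := hb (by simp) (by simp) (by omega)
      have e3 : b (n + 2) ≤ 0 := hb0 _
      have e4 := turan_div_le hb (x := x) (by linarith) hn
      have p1 := turan_pos (x := x) (n := m) hb0 (by linarith) (by linarith)
      have p2 := turan_pos (x := x) (n := n) hb0 (by linarith) (by linarith)
      rw [div_le_iff₀ (by linarith)] at e4
      have e5 : turan b x n ≤ 4 * turan b x m / (c + b (m + 2)) := by
        refine e4.trans ?_
        calc turan b x m / (2 - x + b (m + 2)) * (2 - x + b (n + 2))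
            ≤ turan b x m / (c + b (m + 2)) * 4 := by
              gcongr
              · linarith
              · linarith
          _ = _ := by ring
      rw [norm_mul, Real.norm_eq_abs, Real.norm_eq_abs, abs_mul, mul_div_assoc, abs_of_pos p2,
        abs_of_pos (show 0 < 4 * turan b x m by positivity)]
      exact mul_le_mul_of_nonneg_left e5 (abs_nonneg _)
  · refine Eventually.of_forall fun x => ?_
    by_cases hx : 2 - c < |x|
    · simp [hsupp x hx]
    · push Not at hx
      have hx' := abs_le.1 hx
      exact (tendsto_turan hb hb0 hlim ⟨by linarith, by linarith⟩).const_mul _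

lemma jacobiWeight_pos (hb : MonotoneOn b (Ici 1)) (hb0 : ∀ n, b (n + 1) ≤ 0)
    (hlim : Tendsto b atTop (𝓝 0)) {x : ℝ} (hx : x ∈ Ioo (-2 : ℝ) 2) : 0 < jacobiWeight b x := by
  have h1 : 0 < 4 - x ^ 2 := by nlinarith [hx.1, hx.2]
  have h2 := turanLim_pos hb hb0 hlim hx
  have := Real.pi_pos
  unfold jacobiWeight
  positivity

lemma continuousOn_jacobiWeight (hb : MonotoneOn b (Ici 1)) (hb0 : ∀ n, b (n + 1) ≤ 0)
    (hlim : Tendsto b atTop (𝓝 0)) : ContinuousOn (jacobiWeight b) (Ioo (-2) 2) :=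
  ContinuousOn.div (Continuous.continuousOn (by fun_prop)) (continuousOn_turanLim hb hb0 hlim)
    fun _ hx => (turanLim_pos hb hb0 hlim hx).ne'

/-- A continuous cutoff function equal to `1` for `|x| ≤ 2 - 2 c` and to `0` for `|x| ≥ 2 - c`. -/
noncomputable def cutoff (c x : ℝ) : ℝ := max 0 (min 1 ((2 - c - |x|) / c))

lemma cutoff_eq_zero {c x : ℝ} (hc : 0 < c) (hx : 2 - c ≤ |x|) : cutoff c x = 0 :=
  max_eq_left ((min_le_right _ _).trans (div_nonpos_of_nonpos_of_nonneg (by linarith) hc.le))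

lemma cutoff_eq_one {c x : ℝ} (hc : 0 < c) (hx : |x| ≤ 2 - 2 * c) : cutoff c x = 1 := by
  have : 1 ≤ (2 - c - |x|) / c := by rw [le_div_iff₀ hc]; linarith
  simp [cutoff, this]

lemma cutoff_nonneg (c x : ℝ) : 0 ≤ cutoff c x := le_max_left _ _

lemma cutoff_le_one (c x : ℝ) : cutoff c x ≤ 1 := max_le zero_le_one (min_le_left _ _)

lemma continuous_cutoff (c : ℝ) : Continuous (cutoff c) := by unfold cutoff; fun_prop

lemma integral_mul_cutoff (h : HasJacobiParameters μ (fun _ => 1) b)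
    (hb : MonotoneOn b (Ici 1)) (hb0 : ∀ n, b (n + 1) ≤ 0) (hlim : Tendsto b atTop (𝓝 0))
    {g : ℝ → ℝ} (hg : Continuous g) {c : ℝ} (hc : 0 < c) (hc1 : c ≤ 1) :
    ∫ x, cutoff c x * g x ∂μ = ∫ x in Ioo (-2 : ℝ) 2, (cutoff c x * jacobiWeight b x) * g x := by
  -- Clamping x into [-(2 - c), 2 - c] makes the division by `turanLim` continuous on the whole line
  -- and changes nothing where the cutoff is nonzero.
  set r : ℝ → ℝ := fun x => max (-(2 - c)) (min (2 - c) x) with hr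
  have hrc : Continuous r := by fun_prop
  have hrm : ∀ x, r x ∈ Ioo (-2 : ℝ) 2 := fun x =>
    ⟨(by linarith : (-2 : ℝ) < -(2 - c)).trans_le (le_max_left _ _),
      (max_le (by linarith) (min_le_left _ _)).trans_lt (by linarith : 2 - c < 2)⟩
  have hre : ∀ x, |x| ≤ 2 - c → r x = x := fun x hx => by
    have := abs_le.1 hx
    simp only [hr]
    rw [min_eq_right this.2, max_eq_right this.1]
  have hLc : Continuous fun x => turanLim b (r x) :=
    (continuousOn_turanLim hb hb0 hlim).comp_continuous hrc hrm
  have hLpos : ∀ x, turanLim b (r x) ≠ 0 := fun x => (turanLim_pos hb hb0 hlim (hrm x)).ne'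
  have hf : Continuous fun x => cutoff c x * g x / turanLim b (r x) :=
    ((continuous_cutoff c).mul hg).div hLc hLpos
  have key := integral_mul_turanLim h hb hb0 hlim hf hc
    (fun x hx => by simp [cutoff_eq_zero hc hx.le])
  have e1 : ∀ x, cutoff c x * g x / turanLim b (r x) * turanLim b x = cutoff c x * g x := fun x => by
    by_cases hx : 2 - c ≤ |x|
    · simp [cutoff_eq_zero hc hx]
    · have := hre x (not_le.1 hx).le
      have h2 := hLpos x
      rw [this] at h2 ⊢
      exact div_mul_cancel₀ _ h2
  have e2 : ∀ x, cutoff c x * g x / turanLim b (r x) * (√(4 - x ^ 2) / (2 * Real.pi))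
      = (cutoff c x * jacobiWeight b x) * g x := fun x => by
    by_cases hx : 2 - c ≤ |x|
    · simp [cutoff_eq_zero hc hx]
    · rw [hre x (not_le.1 hx).le, jacobiWeight]; ring
  simpa only [e1, e2] using key

/-- The cutoff makes both measures finite, so they are determined by their integrals against bounded
continuous functions. -/
lemma restrict_cutoff (h : HasJacobiParameters μ (fun _ => 1) b)
    (hb : MonotoneOn b (Ici 1)) (hb0 : ∀ n, b (n + 1) ≤ 0) (hlim : Tendsto b atTop (𝓝 0))
    {c : ℝ} (hc : 0 < c) (hc1 : c ≤ 1) :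
    μ.withDensity (fun x => ENNReal.ofReal (cutoff c x)) =
      (volume.restrict (Ioo (-2) 2)).withDensity
        (fun x => ENNReal.ofReal (cutoff c x * jacobiWeight b x)) := by
  have := h.isProbabilityMeasure
  obtain ⟨R, hR2, hR⟩ := h.exists_bound
  have hcm := (continuous_cutoff c).measurable
  have hwm : AEMeasurable (fun x => cutoff c x * jacobiWeight b x)
      (volume.restrict (Ioo (-2) 2)) :=
    ((continuous_cutoff c).continuousOn.mul
      (continuousOn_jacobiWeight hb hb0 hlim)).aemeasurable measurableSet_Ioo
  obtain ⟨K, hK⟩ := (isCompact_Icc (a := -(2 - c)) (b := 2 - c)).exists_bound_of_continuousOn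
    ((continuousOn_jacobiWeight hb hb0 hlim).mono
      (Icc_subset_Ioo (by linarith) (by linarith)))
  have hnn : ∀ x ∈ Ioo (-2 : ℝ) 2, 0 ≤ cutoff c x * jacobiWeight b x := fun x hx =>
    mul_nonneg (cutoff_nonneg _ _) (jacobiWeight_pos hb hb0 hlim hx).le
  have hbd : ∀ x, ‖cutoff c x * jacobiWeight b x‖ ≤ |K| := fun x => by
    by_cases hx : 2 - c ≤ |x|
    · simp [cutoff_eq_zero hc hx]
    · have h1 := hK x (abs_le.1 (not_le.1 hx).le)
      rw [norm_mul, Real.norm_of_nonneg (cutoff_nonneg _ _)]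
      calc _ ≤ 1 * ‖jacobiWeight b x‖ :=
            mul_le_mul_of_nonneg_right (cutoff_le_one c x) (norm_nonneg _)
        _ ≤ |K| := by rw [one_mul]; exact h1.trans (le_abs_self K)
  have hint : Integrable (fun x => cutoff c x * jacobiWeight b x)
      (volume.restrict (Ioo (-2) 2)) :=
    Integrable.of_bound hwm.aestronglyMeasurable |K| (Eventually.of_forall hbd)
  have : IsFiniteMeasure (μ.withDensity (fun x => ENNReal.ofReal (cutoff c x))) :=
    isFiniteMeasure_withDensity_ofReal
      (integrable_of_continuous hR (continuous_cutoff c)).2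
  have : IsFiniteMeasure ((volume.restrict (Ioo (-2) 2)).withDensity
        (fun x => ENNReal.ofReal (cutoff c x * jacobiWeight b x))) :=
    isFiniteMeasure_withDensity_ofReal hint.2
  refine ext_of_forall_integral_eq_of_IsFiniteMeasure fun g => ?_
  rw [integral_withDensity_eq_integral_toReal_smul₀ (by fun_prop) (by simp),
    integral_withDensity_eq_integral_toReal_smul₀ (by fun_prop) (by simp)]
  have := integral_mul_cutoff h hb hb0 hlim g.continuous hc hc1
  simp only [smul_eq_mul, ENNReal.toReal_ofReal (cutoff_nonneg _ _)]
  rw [this]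
  refine setIntegral_congr_fun measurableSet_Ioo fun x hx => ?_
  simp only [ENNReal.toReal_ofReal (hnn x hx)]

/-- On `(-2, 2)` the spectral measure is absolutely continuous with density `jacobiWeight b`. -/
theorem restrict_eq_withDensity_jacobiWeight (h : HasJacobiParameters μ (fun _ => 1) b)
    (hb : MonotoneOn b (Ici 1)) (hb0 : ∀ n, b (n + 1) ≤ 0) (hlim : Tendsto b atTop (𝓝 0)) :
    μ.restrict (Ioo (-2) 2) = (volume.restrict (Ioo (-2) 2)).withDensity
      (fun x => ENNReal.ofReal (jacobiWeight b x)) := by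
  set ν := (volume.restrict (Ioo (-2 : ℝ) 2)).withDensity
    (fun x => ENNReal.ofReal (jacobiWeight b x)) with hν
  have hν2 : ν.restrict (Ioo (-2) 2) = ν := by
    rw [hν, restrict_withDensity measurableSet_Ioo, Measure.restrict_restrict measurableSet_Ioo,
      inter_self]
  rw [← hν2]
  have hc : ∀ n : ℕ, 0 < 1 / ((n : ℝ) + 1) ∧ 1 / ((n : ℝ) + 1) ≤ 1 := fun n =>
    ⟨by positivity, by rw [div_le_one (by positivity)]; linarith [n.cast_nonneg (α := ℝ)]⟩
  -- On the n-th set the cutoff with c = 1/(n + 1) equals 1, and these sets exhaust the interval.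
  have hU : Ioo (-2 : ℝ) 2 = ⋃ n : ℕ, {x | |x| ≤ 2 - 2 * (1 / ((n : ℝ) + 1))} := by
    ext x
    simp only [mem_iUnion, mem_ofPred_eq, ← abs_lt (a := x), mem_Ioo]
    constructor
    · intro hx
      obtain ⟨n, hn⟩ := exists_nat_one_div_lt (show 0 < (2 - |x|) / 2 by linarith)
      exact ⟨n, by linarith⟩
    · rintro ⟨n, hn⟩
      linarith [(hc n).1]
  rw [hU, Measure.restrict_iUnion_congr]
  intro n
  obtain ⟨hc0, hc1⟩ := hc n
  set c := 1 / ((n : ℝ) + 1)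
  have key := restrict_cutoff h hb hb0 hlim hc0 hc1
  have hS : MeasurableSet {x : ℝ | |x| ≤ 2 - 2 * c} :=
    measurableSet_le (by fun_prop) (by fun_prop)
  have e := congrArg (fun m => Measure.restrict m {x : ℝ | |x| ≤ 2 - 2 * c}) key
  simp only [restrict_withDensity hS] at e
  rw [hν, restrict_withDensity hS]
  have e1 : (μ.restrict {x : ℝ | |x| ≤ 2 - 2 * c}).withDensity
      (fun x => ENNReal.ofReal (cutoff c x)) = μ.restrict {x : ℝ | |x| ≤ 2 - 2 * c} := by
    rw [withDensity_congr_ae (g := 1), withDensity_one]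
    filter_upwards [ae_restrict_mem hS] with x hx
    simp [cutoff_eq_one hc0 hx]
  rw [← e1, e]
  refine withDensity_congr_ae ?_
  filter_upwards [ae_restrict_mem hS] with x hx
  rw [cutoff_eq_one hc0 hx, one_mul]

end Density

/-! ### The Taylor expansion of arcosh(1 + z/2) and its remainder. -/

section Arcosh

/-- The Taylor coefficients of `arcosh (1 + z / 2) / √z`. -/
noncomputable def arcoshCoeff (l : ℕ) : ℝ :=
  Ring.choose (-1 / 2 : ℝ) l / (4 ^ l * (2 * l + 1))

lemma hasSum_one_add_rpow {a y : ℝ} (hy : |y| < 1) :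
    HasSum (fun l : ℕ => Ring.choose a l * y ^ l) ((1 + y) ^ a) := by
  have h := (Real.one_add_rpow_hasFPowerSeriesOnBall_zero (a := a)).hasSum (y := y)
    (by simpa [enorm_eq_nnnorm] using! hy)
  simpa [binomialSeries, mul_comm] using h

/-- The binomial series of (1 + t²)^(-1/2) is integrated term by term, dominated by its absolute
values at t = y. -/
lemma hasSum_arsinh {y : ℝ} (hy0 : 0 ≤ y) (hy : y < 1) :
    HasSum (fun l : ℕ => Ring.choose (-1 / 2 : ℝ) l * (y ^ (2 * l + 1) / (2 * l + 1)))
      (Real.arsinh y) := by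
  have hsum : ∀ t : ℝ, 0 ≤ t → t ≤ y → HasSum (fun l : ℕ => Ring.choose (-1 / 2 : ℝ) l * t ^ (2 * l))
      (√(1 + t ^ 2))⁻¹ := by
    intro t ht hty
    have := hasSum_one_add_rpow (a := -1 / 2) (y := t ^ 2)
      (by rw [abs_of_nonneg (sq_nonneg t)]; nlinarith)
    rw [neg_div, Real.rpow_neg (by positivity), ← Real.sqrt_eq_rpow] at this
    simpa only [pow_mul, neg_div] using this
  have hint : ∫ t in (0 : ℝ)..y, (√(1 + t ^ 2))⁻¹ = Real.arsinh y := by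
    rw [intervalIntegral.integral_eq_sub_of_hasDerivAt (fun t _ => Real.hasDerivAt_arsinh t)]
    · simp
    · refine Continuous.intervalIntegrable (Continuous.inv₀ (by fun_prop) fun t => ?_) _ _
      positivity
  rw [← hint]
  have := intervalIntegral.hasSum_integral_of_dominated_convergence (μ := volume) (a := 0) (b := y)
    (F := fun (l : ℕ) t => Ring.choose (-1 / 2 : ℝ) l * t ^ (2 * l))
    (f := fun t => (√(1 + t ^ 2))⁻¹)
    (fun (l : ℕ) _ => |Ring.choose (-1 / 2 : ℝ) l * y ^ (2 * l)|)
    (fun l => Continuous.aestronglyMeasurable (by fun_prop))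
    (fun l => Eventually.of_forall fun t ht => by
      rw [uIoc_of_le hy0] at ht
      rw [Real.norm_eq_abs, abs_mul, abs_mul, abs_of_nonneg (pow_nonneg ht.1.le _),
        abs_of_nonneg (pow_nonneg hy0 _)]
      have := ht.1.le
      have := ht.2
      gcongr)
    (Eventually.of_forall fun t _ => (hsum y hy0 le_rfl).summable.abs)
    (by simp)
    (Eventually.of_forall fun t ht => by
      rw [uIoc_of_le hy0] at ht
      exact hsum t ht.1.le ht.2)
  have e : ∀ l : ℕ, ∫ t in (0 : ℝ)..y, Ring.choose (-1 / 2 : ℝ) l * t ^ (2 * l)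
      = Ring.choose (-1 / 2 : ℝ) l * (y ^ (2 * l + 1) / (2 * l + 1)) := fun l => by
    rw [intervalIntegral.integral_const_mul, integral_pow]
    simp
  simpa only [e] using this

lemma arcosh_eq_two_mul_arsinh {z : ℝ} (hz : 0 ≤ z) :
    Real.arcosh (1 + z / 2) = 2 * Real.arsinh (√z / 2) := by
  have h : Real.cosh (2 * Real.arsinh (√z / 2)) = 1 + z / 2 := by
    rw [Real.cosh_two_mul, Real.cosh_sq, Real.sinh_arsinh, div_pow, Real.sq_sqrt hz]; ring
  rw [← h, Real.arcosh_cosh]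
  have := Real.arsinh_nonneg_iff.2 (show 0 ≤ √z / 2 by positivity)
  positivity

theorem isArcoshTaylorCoeff_arcoshCoeff : IsArcoshTaylorCoeff arcoshCoeff := by
  intro z hz
  have hs : 0 < √z := Real.sqrt_pos.2 hz.1
  have hs2 : √z ^ 2 = z := Real.sq_sqrt hz.1.le
  have h2 : √z / 2 < 1 := by
    rw [div_lt_one two_pos, Real.sqrt_lt' two_pos]; linarith [hz.2]
  have := (hasSum_arsinh (by positivity) h2).mul_left (2 / √z)
  rw [arcosh_eq_two_mul_arsinh hz.1.le]
  have e5 : ∀ l : ℕ, 2 / √z * (Ring.choose (-1 / 2 : ℝ) l * ((√z / 2) ^ (2 * l + 1) / (2 * l + 1)))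
      = arcoshCoeff l * z ^ l := fun l => by
    have e : √z ^ (2 * l + 1) = z ^ l * √z := by rw [pow_succ, pow_mul, hs2]
    have e4 : (2 : ℝ) ^ (2 * l + 1) = 4 ^ l * 2 := by rw [pow_succ, pow_mul]; norm_num
    rw [div_pow, e, e4, arcoshCoeff]
    field_simp
  have e6 : 2 / √z * Real.arsinh (√z / 2) = 2 * Real.arsinh (√z / 2) / √z := by ring
  simpa only [e5, e6] using this

lemma arcoshCoeff_zero : arcoshCoeff 0 = 1 := by simp [arcoshCoeff]

lemma sqrt_mul_pow {z : ℝ} (hz : 0 < z) (l : ℕ) : √z * z ^ l = z ^ ((l : ℝ) + 1 / 2) := by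
  rw [Real.rpow_add hz, Real.rpow_natCast, ← Real.sqrt_eq_rpow, mul_comm]

/-- The Taylor remainder, uniformly on bounded intervals (possibly beyond the disc of convergence). -/
lemma IsArcoshTaylorCoeff.exists_remainder_le {c : ℕ → ℝ} (hc : IsArcoshTaylorCoeff c) (L : ℕ)
    {C : ℝ} (hC : 0 < C) : ∃ K : ℝ, 0 ≤ K ∧ ∀ z ∈ Icc 0 C,
      |Real.arcosh (1 + z / 2) - ∑ l ∈ Finset.range L, c l * z ^ ((l : ℝ) + 1 / 2)|
        ≤ K * z ^ ((L : ℝ) + 1 / 2) := by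
  have hs2 : Summable fun l => |c (l + L)| * 2 ^ l := by
    have h1 := ((hc 2 ⟨by norm_num, by norm_num⟩).summable.abs.comp_injective
      (add_left_injective L)).mul_right ((2 : ℝ) ^ L)⁻¹
    refine h1.congr fun l => ?_
    simp only [Function.comp, abs_mul, abs_pow, abs_two, pow_add]
    field_simp
  set K1 := ∑' l, |c (l + L)| * 2 ^ l with hK1
  have hK1n : 0 ≤ K1 := tsum_nonneg fun l => by positivity
  set K2 := Real.arcosh (1 + C / 2)
    + ∑ l ∈ Finset.range L, |c l| * C ^ ((l : ℝ) + 1 / 2) with hK2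
  have hK2n : 0 ≤ K2 := add_nonneg (Real.arcosh_nonneg (by linarith))
    (Finset.sum_nonneg fun l _ => by positivity)
  refine ⟨K1 + K2, by positivity, fun z hz => ?_⟩
  rcases hz.1.eq_or_lt with h0 | h0
  · rw [← h0]
    have : ∀ l : ℕ, (0 : ℝ) ^ ((l : ℝ) + 1 / 2) = 0 := fun l =>
      Real.zero_rpow (by positivity)
    simp [this, -one_div]
  -- C may exceed the convergence bound 4. Up to 2 the tail of the series is controlled by K1;
  -- beyond 2 the power of z is at least 1 and the crude bound K2 suffices.
  rcases le_or_gt z 2 with h2 | h2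
  · have hsum := (hc z ⟨h0, by linarith⟩).mul_left (√z)
    rw [mul_div_cancel₀ _ (Real.sqrt_pos.2 h0).ne'] at hsum
    have e : ∀ l, √z * (c l * z ^ l) = c l * z ^ ((l : ℝ) + 1 / 2) := fun l => by
      rw [← sqrt_mul_pow h0]; ring
    simp only [e] at hsum
    have ht := (hasSum_nat_add_iff' L).2 hsum
    rw [← ht.tsum_eq]
    have hle : ∀ l, |c (l + L) * z ^ (((l + L : ℕ) : ℝ) + 1 / 2)|
        ≤ (|c (l + L)| * 2 ^ l) * z ^ ((L : ℝ) + 1 / 2) := fun l => by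
      rw [abs_mul, abs_of_pos (Real.rpow_pos_of_pos h0 _), mul_assoc]
      refine mul_le_mul_of_nonneg_left ?_ (abs_nonneg _)
      rw [← sqrt_mul_pow h0, ← sqrt_mul_pow h0, pow_add]
      have : z ^ l ≤ 2 ^ l := by gcongr
      have h3 : 0 ≤ √z * z ^ L := by positivity
      nlinarith
    rw [← Real.norm_eq_abs]
    calc _ ≤ ∑' l, (|c (l + L)| * 2 ^ l) * z ^ ((L : ℝ) + 1 / 2) :=
          tsum_of_norm_bounded (hs2.mul_right _).hasSum hle
      _ = K1 * z ^ ((L : ℝ) + 1 / 2) := tsum_mul_right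
      _ ≤ (K1 + K2) * z ^ ((L : ℝ) + 1 / 2) := by gcongr; linarith
  · have h1 : |Real.arcosh (1 + z / 2) - ∑ l ∈ Finset.range L, c l * z ^ ((l : ℝ) + 1 / 2)| ≤ K2 := by
      refine (abs_sub _ _).trans (add_le_add ?_ ?_)
      · rw [abs_of_nonneg (Real.arcosh_nonneg (by linarith))]
        exact (Real.arcosh_le_arcosh (by linarith) (by linarith)).2 (by linarith [hz.2])
      · refine (Finset.abs_sum_le_sum_abs _ _).trans (Finset.sum_le_sum fun l _ => ?_)
        rw [abs_mul, abs_of_pos (Real.rpow_pos_of_pos h0 _)]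
        have := hz.2
        gcongr
    have h3 : 1 ≤ z ^ ((L : ℝ) + 1 / 2) := Real.one_le_rpow (by linarith) (by positivity)
    nlinarith

end Arcosh

/-! ### Power sums compared with Beta integrals. -/

section PowerSums

lemma integral_rpow_mul_sub_rpow {a u v : ℝ} (ha : 0 < a) (hu : 0 < u) (hv : 0 < v) :
    ∫ y in (0 : ℝ)..a, y ^ (u - 1) * (a - y) ^ (v - 1)
      = a ^ (u + v - 1) * (Real.Gamma u * Real.Gamma v / Real.Gamma (u + v)) := by
  have h := Complex.betaIntegral_scaled u v ha
  rw [Complex.betaIntegral_eq_Gamma_mul_div _ _ (by simpa) (by simpa)] at h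
  apply Complex.ofReal_injective
  rw [← intervalIntegral.integral_ofReal]
  push_cast
  rw [Complex.ofReal_cpow ha.le, ← Complex.Gamma_ofReal, ← Complex.Gamma_ofReal,
    ← Complex.Gamma_ofReal]
  push_cast
  rw [← h]
  refine intervalIntegral.integral_congr fun y hy => ?_
  rw [uIcc_of_le ha.le] at hy
  rw [Complex.ofReal_cpow hy.1, Complex.ofReal_cpow (by linarith [hy.2])]
  push_cast
  rfl

/-- The `s`-th power of the positive part of `C t ^ (-β) - δ`. -/
noncomputable def excess (C β δ s t : ℝ) : ℝ := (max 0 (C * t ^ (-β) - δ)) ^ s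

variable {C β δ s : ℝ}

lemma excess_nonneg (t : ℝ) : 0 ≤ excess C β δ s t := Real.rpow_nonneg (le_max_left _ _) _

lemma antitoneOn_excess (hC : 0 < C) (hβ : 0 < β) (hs : 0 < s) :
    AntitoneOn (excess C β δ s) (Ioi 0) := by
  intro t ht u hu htu
  have h1 : u ^ (-β) ≤ t ^ (-β) := Real.rpow_le_rpow_of_nonpos ht htu (by linarith)
  refine Real.rpow_le_rpow (le_max_left _ _) (max_le_max le_rfl ?_) hs.le
  have := mul_le_mul_of_nonneg_left h1 hC.le
  linarith

lemma excess_le (hC : 0 < C) (hδ : 0 < δ) (hs : 0 < s) {t : ℝ} (ht : 0 < t) :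
    excess C β δ s t ≤ C ^ s * t ^ (-(β * s)) := by
  have h1 : 0 < t ^ (-β) := Real.rpow_pos_of_pos ht _
  rw [← neg_mul, Real.rpow_mul ht.le, ← Real.mul_rpow hC.le h1.le]
  refine Real.rpow_le_rpow (le_max_left _ _) (max_le (by positivity) (by linarith)) hs.le

lemma le_mul_rpow_iff (hC : 0 < C) (hβ : 0 < β) (hδ : 0 < δ) {t : ℝ} (ht : 0 < t) :
    δ ≤ C * t ^ (-β) ↔ t ≤ (C / δ) ^ (1 / β) := by
  rw [one_div, Real.le_rpow_inv_iff_of_pos ht.le (by positivity) hβ, Real.rpow_neg ht.le,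
    ← div_eq_mul_inv, le_div_iff₀ (by positivity), le_div_iff₀ hδ, mul_comm]

lemma excess_eq_zero (hC : 0 < C) (hβ : 0 < β) (hδ : 0 < δ) (hs : 0 < s) {t : ℝ} (ht : 0 < t)
    (h : (C / δ) ^ (1 / β) < t) : excess C β δ s t = 0 := by
  have := (le_mul_rpow_iff hC hβ hδ ht).not.2 (not_le.2 h)
  rw [excess, max_eq_left (by linarith), Real.zero_rpow hs.ne']

lemma integral_excess (hC : 0 < C) (hβ : 0 < β) (hδ : 0 < δ) (hs : 0 < s) (hsβ : s < 1 / β) :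
    ∫ t in Ioi (0 : ℝ), excess C β δ s t = β⁻¹ * C ^ (1 / β) *
      (Real.Gamma (s + 1) * Real.Gamma (1 / β - s) / Real.Gamma (1 / β + 1)) *
        δ ^ (s - 1 / β) := by
  have hβ' : 0 < 1 / β := by positivity
  set a := C / δ with ha
  have ha0 : 0 < a := by positivity
  -- Putting t = y^(1/β) turns C t^(-β) into C/y and leaves a Beta integral over (0, C/δ),
  -- convergent at 0 because s < 1/β.
  rw [← integral_comp_rpow_Ioi_of_pos hβ']
  have h1 : ∀ y ∈ Ioi (0 : ℝ), (1 / β * y ^ (1 / β - 1)) • excess C β δ s (y ^ (1 / β))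
      = (Ioc 0 a).indicator (fun y => β⁻¹ * δ ^ s * (y ^ ((1 / β - s) - 1) *
        (a - y) ^ ((s + 1) - 1))) y := by
    intro y hy
    have hy : 0 < y := hy
    have e1 : C * (y ^ (1 / β)) ^ (-β) = C / y := by
      rw [← Real.rpow_mul hy.le]
      have : 1 / β * -β = -1 := by field_simp
      rw [this, Real.rpow_neg_one, div_eq_mul_inv]
    by_cases hya : y ≤ a
    · rw [indicator_of_mem (show y ∈ Ioc 0 a from ⟨hy, hya⟩), excess, e1]
      have e2 : C / y - δ = δ * ((a - y) * y⁻¹) := by rw [ha]; field_simp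
      have e3 : 0 ≤ a - y := by linarith
      rw [max_eq_right (by rw [e2]; positivity), e2, Real.mul_rpow hδ.le (by positivity),
        Real.mul_rpow e3 (by positivity), Real.inv_rpow hy.le, ← Real.rpow_neg hy.le, smul_eq_mul,
        add_sub_cancel_right, show 1 / β - s - 1 = (1 / β - 1) + -s by ring, Real.rpow_add hy,
        one_div]
      ring
    · rw [indicator_of_notMem (fun h => hya h.2), excess, e1]
      have : C / y - δ ≤ 0 := by
        rw [sub_nonpos, div_le_iff₀ hy]
        have := (div_lt_iff₀ hδ).1 (not_le.1 hya)
        linarith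
      rw [max_eq_left this, Real.zero_rpow hs.ne', smul_zero]
  rw [setIntegral_congr_fun measurableSet_Ioi h1, setIntegral_indicator measurableSet_Ioc,
    inter_eq_right.2 Ioc_subset_Ioi_self, ← intervalIntegral.integral_of_le ha0.le,
    intervalIntegral.integral_const_mul, integral_rpow_mul_sub_rpow ha0 (by linarith) (by linarith),
    show 1 / β - s + (s + 1) - 1 = 1 / β by ring, show 1 / β - s + (s + 1) = 1 / β + 1 by ring,
    ha, Real.div_rpow hC.le hδ.le, Real.rpow_sub hδ]
  ring

/-- Comparison of the power sums with their integral. -/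
lemma exists_abs_sum_excess_sub_le (hC : 0 < C) (hβ : 0 < β) (hs : 0 < s) (hsβ : s < 1 / β) :
    ∃ K : ℝ, ∀ δ : ℝ, 0 < δ →
      |∑ k ∈ Finset.range ⌊(C / δ) ^ (1 / β)⌋₊, excess C β δ s ((k + 1 : ℕ) : ℝ)
        - ∫ t in Ioi (0 : ℝ), excess C β δ s t| ≤ K := by
  have hβs : β * s < 1 := by rwa [lt_div_iff₀ hβ, mul_comm] at hsβ
  have hint0 : IntervalIntegrable (fun t : ℝ => C ^ s * t ^ (-(β * s))) volume 0 1 :=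
    (intervalIntegral.intervalIntegrable_rpow' (by linarith)).const_mul _
  -- For a decreasing function the discrepancy is at most the first term plus the integral over (0,
  -- 1); both are bounded independently of δ, as β s < 1.
  refine ⟨C ^ s + ∫ t in (0 : ℝ)..1, C ^ s * t ^ (-(β * s)), fun δ hδ => ?_⟩
  set T := (C / δ) ^ (1 / β) with hT
  set N := ⌊T⌋₊ with hN
  set h := excess C β δ s with hh
  have hanti : AntitoneOn h (Ioi 0) := antitoneOn_excess hC hβ hs
  have hTN : T < N + 1 := Nat.lt_floor_add_one T
  have hmeas : Measurable h := by
    rw [hh]; unfold excess; fun_prop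
  have i01 : IntervalIntegrable h volume 0 1 := by
    refine hint0.mono_fun hmeas.aestronglyMeasurable ?_
    filter_upwards [ae_restrict_mem measurableSet_uIoc] with t ht
    rw [uIoc_of_le zero_le_one] at ht
    rw [Real.norm_of_nonneg (excess_nonneg t)]
    exact (excess_le hC hδ hs ht.1).trans (le_abs_self _)
  have hantiI : AntitoneOn h (Icc 1 (1 + (N : ℝ))) :=
    hanti.mono fun t ht => lt_of_lt_of_le one_pos ht.1
  have i1N : IntervalIntegrable h volume 1 (1 + (N : ℝ)) := by
    refine AntitoneOn.intervalIntegrable ?_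
    rwa [uIcc_of_le (by linarith [N.cast_nonneg (α := ℝ)])]
  have hsplit : ∫ t in Ioi (0 : ℝ), h t = (∫ t in (0 : ℝ)..1, h t)
      + ∫ t in (1 : ℝ)..(1 + (N : ℝ)), h t := by
    rw [intervalIntegral.integral_add_adjacent_intervals i01 i1N,
      intervalIntegral.integral_of_le (by positivity)]
    refine setIntegral_eq_of_subset_of_forall_sdiff_eq_zero measurableSet_Ioi
      Ioc_subset_Ioi_self fun t ht => ?_
    have h1 : 0 < t := ht.1
    have h2 : 1 + (N : ℝ) < t := by
      by_contra hcon
      exact ht.2 ⟨h1, not_lt.1 hcon⟩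
    exact excess_eq_zero hC hβ hδ hs h1 (by linarith)
  have hle := hantiI.integral_le_sum
  have hge := hantiI.sum_le_integral
  have hlast : h (1 + (N : ℝ)) = 0 :=
    excess_eq_zero hC hβ hδ hs (by positivity) (by linarith)
  have hfirst : h 1 ≤ C ^ s := by
    have := excess_le (β := β) hC hδ hs one_pos
    simpa using this
  have e1 : ∑ k ∈ Finset.range N, h ((k + 1 : ℕ) : ℝ) = ∑ k ∈ Finset.range N, h (1 + (k : ℝ)) :=
    Finset.sum_congr rfl fun k _ => by push_cast; rw [add_comm]
  have e2 : ∑ k ∈ Finset.range N, h (1 + ((k + 1 : ℕ) : ℝ)) + h 1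
      = ∑ k ∈ Finset.range N, h (1 + (k : ℝ)) + h (1 + (N : ℝ)) := by
    rw [← Finset.sum_range_succ (fun k : ℕ => h (1 + (k : ℝ))), Finset.sum_range_succ']
    simp
  have i0 : 0 ≤ ∫ t in (0 : ℝ)..1, h t :=
    intervalIntegral.integral_nonneg zero_le_one fun t _ => excess_nonneg t
  have i1 : ∫ t in (0 : ℝ)..1, h t ≤ ∫ t in (0 : ℝ)..1, C ^ s * t ^ (-(β * s)) := by
    refine intervalIntegral.integral_mono_on_of_le_Ioo zero_le_one i01 hint0 fun t ht => ?_
    exact excess_le hC hδ hs ht.1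
  have hCs : 0 < C ^ s := Real.rpow_pos_of_pos hC _
  rw [e1, hsplit, abs_le]
  constructor <;> linarith

end PowerSums

/-! ### Asymptotics of log L for the potential -C n^(-β). -/

section PowerPotential

variable {C β δ : ℝ}

/-- The diagonal Jacobi parameters `-C n ^ (-β)`. -/
noncomputable def powerPotential (C β : ℝ) (n : ℕ) : ℝ := -C * (n : ℝ) ^ (-β)

lemma monotoneOn_powerPotential (hC : 0 < C) (hβ : 0 < β) :
    MonotoneOn (powerPotential C β) (Ici 1) := by
  intro m hm n hn hmn
  have hm' : (0 : ℝ) < m := by exact_mod_cast hm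
  have : (n : ℝ) ^ (-β) ≤ (m : ℝ) ^ (-β) :=
    Real.rpow_le_rpow_of_nonpos hm' (by exact_mod_cast hmn) (by linarith)
  unfold powerPotential
  nlinarith

lemma powerPotential_nonpos (hC : 0 < C) (n : ℕ) : powerPotential C β n ≤ 0 := by
  have : (0 : ℝ) ≤ (n : ℝ) ^ (-β) := by positivity
  unfold powerPotential
  nlinarith

lemma tendsto_powerPotential (hβ : 0 < β) : Tendsto (powerPotential C β) atTop (𝓝 0) := by
  have := ((tendsto_rpow_neg_atTop hβ).comp tendsto_natCast_atTop_atTop).const_mul (-C)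
  rwa [mul_zero] at this

/-- The number of sites in the classically forbidden region at energy `2 - δ`. -/
noncomputable def forbiddenCount (C β δ : ℝ) : ℕ := ⌊(C / δ) ^ (1 / β)⌋₊

/-- The local growth rate at the site `k` at energy `2 - δ`. -/
noncomputable def growthRate (C β δ : ℝ) (k : ℕ) : ℝ :=
  Real.arcosh (1 + (C * (k : ℝ) ^ (-β) - δ) / 2)

lemma le_of_mem_forbidden (hC : 0 < C) (hβ : 0 < β) (hδ : 0 < δ) {k : ℕ}
    (hk : k ∈ Icc 1 (forbiddenCount C β δ)) : δ ≤ C * (k : ℝ) ^ (-β) := by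
  have hk0 : (0 : ℝ) < k := by exact_mod_cast hk.1
  exact (le_mul_rpow_iff hC hβ hδ hk0).2 ((Nat.le_floor_iff (by positivity)).1 hk.2)

lemma growthRate_spec (hC : 0 < C) (hβ : 0 < β) (hδ : 0 < δ) :
    ∀ k ∈ Icc 1 (forbiddenCount C β δ), 0 ≤ growthRate C β δ k ∧
      2 * Real.cosh (growthRate C β δ k) = 2 - δ - powerPotential C β k := by
  intro k hk
  have h := le_of_mem_forbidden hC hβ hδ hk
  have h1 : 1 ≤ 1 + (C * (k : ℝ) ^ (-β) - δ) / 2 := by linarith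
  refine ⟨Real.arcosh_nonneg h1, ?_⟩
  rw [growthRate, Real.cosh_arcosh h1, powerPotential]; ring

lemma antitoneOn_growthRate (hC : 0 < C) (hβ : 0 < β) (hδ : 0 < δ) :
    AntitoneOn (growthRate C β δ) (Icc 1 (forbiddenCount C β δ)) := by
  intro m hm n hn hmn
  have hm0 := le_of_mem_forbidden hC hβ hδ hm
  have hn0 := le_of_mem_forbidden hC hβ hδ hn
  have := monotoneOn_powerPotential hC hβ (mem_Ici.2 hm.1) (mem_Ici.2 hn.1) hmn
  unfold powerPotential at this
  exact (Real.arcosh_le_arcosh (by linarith) (by linarith)).2 (by linarith)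

/-- Past the forbidden region the distance to the edge of the local band is at least a power of the
site. -/
lemma forbidden_gap (hC : 0 < C) (hβ : 0 < β) (hδ : 0 < δ) :
    0 < δ + powerPotential C β (forbiddenCount C β δ + 1) ∧
    C * β * ((forbiddenCount C β δ + 2 : ℕ) : ℝ) ^ (-(β + 1))
      ≤ δ + powerPotential C β (forbiddenCount C β δ + 2) := by
  set N := forbiddenCount C β δ
  have hN : (C / δ) ^ (1 / β) < ((N + 1 : ℕ) : ℝ) := by
    push_cast; exact Nat.lt_floor_add_one _
  have h1 : C * ((N + 1 : ℕ) : ℝ) ^ (-β) < δ := by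
    by_contra! hcon
    exact absurd ((le_mul_rpow_iff hC hβ hδ (by positivity)).1 hcon) (not_le.2 hN)
  set m : ℝ := ((N + 1 : ℕ) : ℝ) with hm
  have hm0 : 0 < m := by rw [hm]; positivity
  have hm1 : ((N + 2 : ℕ) : ℝ) = m + 1 := by rw [hm]; push_cast; ring
  refine ⟨by unfold powerPotential; linarith, ?_⟩
  unfold powerPotential
  rw [hm1]
  -- The gap at site N + 1 has no uniform lower bound of this kind; one more site adds the decrement
  -- of C t^(-β), estimated here through log((m + 1)/m) ≥ 1/(m + 1).
  have h2 : (m + 1) ^ (-β) * (1 + β * (m + 1)⁻¹) ≤ m ^ (-β) := by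
    have e : m ^ (-β) = (m + 1) ^ (-β) * ((m + 1) / m) ^ β := by
      rw [Real.div_rpow (by linarith) hm0.le, Real.rpow_neg hm0.le, Real.rpow_neg (by linarith)]
      have : 0 < (m + 1) ^ β := Real.rpow_pos_of_pos (by linarith) _
      field_simp
    rw [e]
    gcongr
    have h3 := Real.one_sub_inv_le_log_of_pos (show 0 < (m + 1) / m by positivity)
    have h4 : 1 - ((m + 1) / m)⁻¹ = (m + 1)⁻¹ := by field_simp; ring
    rw [h4] at h3
    rw [Real.rpow_def_of_pos (by positivity)]
    have h5 := Real.add_one_le_exp (Real.log ((m + 1) / m) * β)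
    nlinarith
  have h6 : (m + 1) ^ (-(β + 1)) = (m + 1) ^ (-β) * (m + 1)⁻¹ := by
    rw [neg_add, Real.rpow_add (by linarith), Real.rpow_neg_one]
  rw [h6]
  have h7 := mul_le_mul_of_nonneg_left h2 hC.le
  nlinarith

lemma forbiddenCount_pos (hβ : 0 < β) (hδ : 0 < δ) (hδC : δ ≤ C) :
    1 ≤ forbiddenCount C β δ :=
  Nat.le_floor (by
    rw [Nat.cast_one]
    exact Real.one_le_rpow ((one_le_div hδ).2 hδC) (by positivity))

lemma log_forbiddenCount_le (hC : 0 < C) (hβ : 0 < β) (hδ : 0 < δ) (hδC : δ ≤ C) :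
    Real.log ((forbiddenCount C β δ + 2 : ℕ) : ℝ)
      ≤ (Real.log 3 + 1 / β * Real.log C) + 1 / β * (-Real.log δ) := by
  have h1 : 1 ≤ (C / δ) ^ (1 / β) :=
    Real.one_le_rpow ((one_le_div hδ).2 hδC) (by positivity)
  have h2 : ((forbiddenCount C β δ + 2 : ℕ) : ℝ) ≤ 3 * (C / δ) ^ (1 / β) := by
    have := Nat.floor_le (show 0 ≤ (C / δ) ^ (1 / β) by positivity)
    push_cast
    unfold forbiddenCount
    linarith
  calc _ ≤ Real.log (3 * (C / δ) ^ (1 / β)) := Real.log_le_log (by positivity) h2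
    _ = _ := by
      rw [Real.log_mul (by norm_num) (by positivity), Real.log_rpow (by positivity),
        Real.log_div hC.ne' hδ.ne']
      ring

/-- One recurrence step gives |p_{n+2}| ≤ 3 p_{n+1}, whence 16 = 9 + 2·3 + 1. -/
lemma turan_le_of_jacobiSeq_le {b : ℕ → ℝ} {x : ℝ} {n : ℕ}
    (h0 : 0 < jacobiSeq b x n) (hmono : jacobiSeq b x n ≤ jacobiSeq b x (n + 1))
    (h1 : 0 ≤ x - b (n + 2)) (h1' : x - b (n + 2) ≤ 2)
    (h2 : 0 ≤ x - b (n + 3)) (h2' : x - b (n + 3) ≤ 2) :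
    turan b x (n + 1) ≤ 16 * jacobiSeq b x (n + 1) ^ 2 := by
  have e1 := jacobiSeq_succ_succ b x n
  have e0 : turan b x (n + 1) = jacobiSeq b x (n + 2) ^ 2
    - (x - b (n + 3)) * (jacobiSeq b x (n + 2) * jacobiSeq b x (n + 1))
    + jacobiSeq b x (n + 1) ^ 2 := by rw [turan]; ring
  rw [e0]
  set w := jacobiSeq b x (n + 2)
  set u := jacobiSeq b x (n + 1)
  set v := jacobiSeq b x n
  have hu : 0 < u := h0.trans_le hmono
  have e2 : -(3 * u) ≤ w := by rw [e1]; nlinarith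
  have e3 : w ≤ 3 * u := by rw [e1]; nlinarith
  have e4 : w ^ 2 ≤ 9 * u ^ 2 := by nlinarith
  have e5 : -(w * u) ≤ 3 * u ^ 2 := by nlinarith
  have e6 : (x - b (n + 3)) * -(w * u) ≤ (x - b (n + 3)) * (3 * u ^ 2) :=
    mul_le_mul_of_nonneg_left e5 h2
  have e7 : (x - b (n + 3)) * (3 * u ^ 2) ≤ 2 * (3 * u ^ 2) :=
    mul_le_mul_of_nonneg_right h2' (by positivity)
  linarith

/-- Completing the square leaves the coefficient 1 - (1 - ε/2)² = ε/2 + ε(2 - ε)/4. -/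
lemma le_turan {b : ℕ → ℝ} {x ε : ℝ} {n : ℕ} (hε : x - b (n + 2) = 2 - ε) (h0 : 0 ≤ ε)
    (h2 : ε ≤ 2) : ε / 2 * jacobiSeq b x n ^ 2 ≤ turan b x n := by
  have e : turan b x n = (jacobiSeq b x (n + 1) - (1 - ε / 2) * jacobiSeq b x n) ^ 2
      + ε / 2 * jacobiSeq b x n ^ 2 + ε * (2 - ε) / 4 * jacobiSeq b x n ^ 2 := by
    rw [turan, hε]; ring
  have h3 : 0 ≤ 2 - ε := by linarith
  have h4 : 0 ≤ ε * (2 - ε) / 4 * jacobiSeq b x n ^ 2 := by positivity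
  rw [e]
  linarith [sq_nonneg (jacobiSeq b x (n + 1) - (1 - ε / 2) * jacobiSeq b x n)]

/-- The logarithm of the limiting Turán determinant is the total growth over the forbidden region,
up to a logarithmic error. -/
lemma exists_abs_log_turanLim_sub_le (hC : 0 < C) (hβ : 0 < β) :
    ∃ A B : ℝ, ∀ δ : ℝ, 0 < δ → δ ≤ C → δ ≤ 1 →
      |1 / 2 * Real.log (turanLim (powerPotential C β) (2 - δ))
        - ∑ k ∈ Finset.range (forbiddenCount C β δ), growthRate C β δ (k + 1)|
        ≤ A + B * (-Real.log δ) := by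
  -- Here (β + 3)/2 = 1 + (β + 1)/2: the 1 comes from the factor N + 1 in the bound for p_N, the
  -- rest from -½ log ε with ε ≥ C β (N + 2)^(-(β + 1)).
  refine ⟨1 / 2 * (Real.log 16 + |Real.log (C * β)|)
      + (β + 3) / 2 * (Real.log 3 + 1 / β * Real.log C), (β + 3) / 2 * (1 / β),
    fun δ hδ hδC hδ1 => ?_⟩
  set b := powerPotential C β with hbdef
  have hb : MonotoneOn b (Ici 1) := monotoneOn_powerPotential hC hβ
  have hb0 : ∀ n, b (n + 1) ≤ 0 := fun n => powerPotential_nonpos hC _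
  have hlim : Tendsto b atTop (𝓝 0) := tendsto_powerPotential hβ
  have hγ := growthRate_spec hC hβ hδ
  have hanti := antitoneOn_growthRate hC hβ hδ
  obtain ⟨hgap1, hgap2⟩ := forbidden_gap hC hβ hδ
  have hN1 := forbiddenCount_pos hβ hδ hδC
  have hlogN := log_forbiddenCount_le hC hβ hδ hδC
  set N := forbiddenCount C β δ
  set S := ∑ k ∈ Finset.range N, growthRate C β δ (k + 1)
  set x := 2 - δ with hxdef
  have hx : x ∈ Ioo (-2 : ℝ) 2 := ⟨by linarith, by linarith⟩
  have hlow : Real.exp S ≤ jacobiSeq b x N := exp_sum_le_jacobiSeq hγ hanti le_rfl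
  have hup : jacobiSeq b x N ≤ (N + 1) * Real.exp S := jacobiSeq_le_mul_exp_sum hγ hanti le_rfl
  have hS0 := Real.exp_pos S
  -- T_N involves b at N + 2, exactly where the gap is bounded below.
  set ε := δ + b (N + 2) with hε
  have hεx : 2 - x + b (N + 2) = ε := by rw [hxdef, hε]; ring
  have hε0 : 0 < ε := lt_of_lt_of_le (by positivity) hgap2
  have hε1 : ε ≤ 1 := by have : b (N + 2) ≤ 0 := hb0 _; linarith
  have hb2 : x - b (N + 2) = 2 - ε := by linarith
  have hT_up : turan b x N ≤ 16 * jacobiSeq b x N ^ 2 := by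
    obtain ⟨M, hM⟩ : ∃ M, N = M + 1 := ⟨N - 1, by omega⟩
    have h0 := jacobiSeq_lower hγ hanti (n := M) (by omega)
    have hg := (hγ (M + 1) ⟨by omega, by omega⟩).1
    have hexp : 1 ≤ Real.exp (growthRate C β δ (M + 1)) := Real.one_le_exp hg
    have hmono : jacobiSeq b x M ≤ jacobiSeq b x (M + 1) :=
      (le_mul_of_one_le_left h0.1.le hexp).trans h0.2
    have hbN0 : b (N + 1) ≤ 0 := hb0 _
    have hbN1 : 0 ≤ x - b (N + 1) := by linarith
    have hbN2 : x - b (N + 1) ≤ 2 := by linarith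
    have hbN3 : 0 ≤ x - b (N + 2) := by linarith
    have hbN4 : x - b (N + 2) ≤ 2 := by linarith
    rw [hM] at hbN1 hbN2 hbN3 hbN4 ⊢
    exact turan_le_of_jacobiSeq_le h0.1 hmono hbN1 hbN2 hbN3 hbN4
  have hT_low : ε / 2 * jacobiSeq b x N ^ 2 ≤ turan b x N := le_turan hb2 hε0.le (by linarith)
  have hL_up : turanLim b x ≤ 16 * ((N + 1) * Real.exp S) ^ 2 / ε := by
    have h1 := turanLim_div_le hb hb0 hlim hx (m := N) (by rw [hεx]; exact hε0)
    rw [hεx, div_le_iff₀ (by linarith)] at h1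
    have hn : 0 ≤ jacobiSeq b x N := hS0.le.trans hlow
    have h2 : turan b x N ≤ 16 * ((N + 1) * Real.exp S) ^ 2 := hT_up.trans (by gcongr)
    have h3 : 0 ≤ turan b x N := (by positivity : 0 ≤ ε / 2 * jacobiSeq b x N ^ 2).trans hT_low
    calc turanLim b x ≤ turan b x N / ε * (2 - x) := h1
      _ ≤ turan b x N / ε * 1 := by gcongr; linarith
      _ ≤ _ := by rw [mul_one]; gcongr
  have hL_low : ε / 4 * Real.exp S ^ 2 ≤ turanLim b x := by
    have h1 := div_turanLim_le hb hb0 hlim hx N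
    have h4 : 2 + x - b (N + 2) = 4 - ε := by linarith
    have hpos : 0 < turanLim b x := turanLim_pos hb hb0 hlim hx
    rw [h4, div_le_div_iff₀ (by linarith) (by linarith)] at h1
    have h2 : ε / 2 * Real.exp S ^ 2 ≤ turan b x N := le_trans (by gcongr) hT_low
    have h3 : 0 ≤ turan b x N := (by positivity : 0 ≤ ε / 2 * Real.exp S ^ 2).trans h2
    nlinarith
  have hlog_up := Real.log_le_log (turanLim_pos hb hb0 hlim hx) hL_up
  have hlog_low := Real.log_le_log (by positivity) hL_low
  rw [Real.log_div (by positivity) hε0.ne', Real.log_mul (by norm_num) (by positivity),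
    Real.log_pow, Real.log_mul (by positivity) hS0.ne', Real.log_exp] at hlog_up
  rw [Real.log_mul (by positivity) (by positivity), Real.log_div hε0.ne' (by norm_num),
    Real.log_pow, Real.log_exp] at hlog_low
  have hlogε := Real.log_le_log (by positivity) hgap2
  rw [Real.log_mul (by positivity) (by positivity), Real.log_rpow (by positivity)] at hlogε
  have hlogN1 : Real.log ((N : ℝ) + 1) ≤ Real.log ((N + 2 : ℕ) : ℝ) :=
    Real.log_le_log (by positivity) (by push_cast; linarith)
  have hlogN0 : 0 ≤ Real.log ((N + 2 : ℕ) : ℝ) := Real.log_natCast_nonneg _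
  have h416 : Real.log 4 ≤ Real.log 16 := Real.log_le_log (by norm_num) (by norm_num)
  have habs := neg_abs_le (Real.log (C * β))
  have hfin : |1 / 2 * Real.log (turanLim b x) - S| ≤ 1 / 2 * (Real.log 16 + |Real.log (C * β)|)
      + (β + 3) / 2 * Real.log ((N + 2 : ℕ) : ℝ) := by
    push_cast at hlog_up hlog_low hlogε hlogN1 hlogN0 ⊢
    rw [abs_le]; constructor <;> nlinarith
  refine hfin.trans ?_
  have := mul_le_mul_of_nonneg_left hlogN (show 0 ≤ (β + 3) / 2 by positivity)
  nlinarith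

/-- The total growth over the forbidden region in terms of power sums. -/
lemma exists_abs_sum_growthRate_sub_le {c : ℕ → ℝ} (hc : IsArcoshTaylorCoeff c) (hC : 0 < C)
    (hβ : 0 < β) : ∃ A B : ℝ, ∀ δ : ℝ, 0 < δ → δ ≤ C →
      |∑ k ∈ Finset.range (forbiddenCount C β δ), growthRate C β δ (k + 1)
        - ∑ l ∈ Finset.range ⌈1 / β - 1 / 2⌉₊, c l *
          ∑ k ∈ Finset.range (forbiddenCount C β δ), excess C β δ (l + 1 / 2) ((k + 1 : ℕ) : ℝ)|
        ≤ A + B * (-Real.log δ) := by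
  set L := ⌈1 / β - 1 / 2⌉₊
  -- This choice of L makes the Taylor remainder at site k of order 1/k, so its sum is harmonic and
  -- yields the logarithmic error.
  have hL : 1 ≤ β * ((L : ℝ) + 1 / 2) := by
    have h1 : 1 / β - 1 / 2 ≤ L := Nat.le_ceil _
    have h2 : 1 / β ≤ (L : ℝ) + 1 / 2 := by linarith
    rwa [div_le_iff₀ hβ, mul_comm] at h2
  obtain ⟨K, hK0, hK⟩ := hc.exists_remainder_le L hC
  set s : ℝ := (L : ℝ) + 1 / 2 with hs
  have hs0 : 0 < s := by positivity
  refine ⟨K * C ^ s * (1 + (Real.log 3 + 1 / β * Real.log C)), K * C ^ s * (1 / β),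
    fun δ hδ hδC => ?_⟩
  have hlogN := log_forbiddenCount_le hC hβ hδ hδC
  have hN1 := forbiddenCount_pos hβ hδ hδC
  have hmem := fun k hk => le_of_mem_forbidden hC hβ hδ (k := k) hk
  set N := forbiddenCount C β δ
  have hterm : ∀ k ∈ Finset.range N,
      |growthRate C β δ (k + 1) - ∑ l ∈ Finset.range L, c l *
        excess C β δ (l + 1 / 2) ((k + 1 : ℕ) : ℝ)| ≤ K * C ^ s * ((k + 1 : ℕ) : ℝ)⁻¹ := by
    intro k hk
    have hk1 : (1 : ℝ) ≤ ((k + 1 : ℕ) : ℝ) := by push_cast; linarith [k.cast_nonneg (α := ℝ)]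
    have hge := hmem (k + 1) ⟨by omega, by have := Finset.mem_range.1 hk; omega⟩
    set t : ℝ := ((k + 1 : ℕ) : ℝ)
    have ht1 : t ^ (-β) ≤ 1 := Real.rpow_le_one_of_one_le_of_nonpos hk1 (by linarith)
    have hmax : max 0 (C * t ^ (-β) - δ) = C * t ^ (-β) - δ := max_eq_right (by linarith)
    have h := hK (C * t ^ (-β) - δ) ⟨by linarith, by nlinarith⟩
    have e1 : (C * t ^ (-β) - δ) ^ s ≤ C ^ s * t ^ (-(β * s)) := by
      have := excess_le (β := β) hC hδ hs0 (lt_of_lt_of_le one_pos hk1)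
      rwa [excess, hmax] at this
    have e2 : t ^ (-(β * s)) ≤ t⁻¹ := by
      rw [← Real.rpow_neg_one]
      exact Real.rpow_le_rpow_of_exponent_le hk1 (by linarith)
    simp only [excess, hmax]
    refine h.trans ?_
    rw [mul_assoc]
    exact mul_le_mul_of_nonneg_left (e1.trans (mul_le_mul_of_nonneg_left e2 (by positivity))) hK0
  have hswap : ∑ l ∈ Finset.range L, c l *
      ∑ k ∈ Finset.range N, excess C β δ (l + 1 / 2) ((k + 1 : ℕ) : ℝ)
      = ∑ k ∈ Finset.range N, ∑ l ∈ Finset.range L, c l *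
        excess C β δ (l + 1 / 2) ((k + 1 : ℕ) : ℝ) := by
    simp only [Finset.mul_sum]
    exact Finset.sum_comm
  have hharm : ∑ k ∈ Finset.range N, ((k + 1 : ℕ) : ℝ)⁻¹ ≤ 1 + Real.log N := by
    have := harmonic_le_one_add_log N
    unfold harmonic at this
    push_cast at this ⊢
    exact this
  have hlog2 : Real.log N ≤ Real.log ((N + 2 : ℕ) : ℝ) :=
    Real.log_le_log (by exact_mod_cast hN1) (by push_cast; linarith)
  rw [hswap, ← Finset.sum_sub_distrib]
  calc _ ≤ ∑ k ∈ Finset.range N, K * C ^ s * ((k + 1 : ℕ) : ℝ)⁻¹ :=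
        (Finset.abs_sum_le_sum_abs _ _).trans (Finset.sum_le_sum hterm)
    _ = K * C ^ s * ∑ k ∈ Finset.range N, ((k + 1 : ℕ) : ℝ)⁻¹ := by rw [Finset.mul_sum]
    _ ≤ K * C ^ s * (1 + ((Real.log 3 + 1 / β * Real.log C) + 1 / β * (-Real.log δ))) := by
        gcongr; linarith
    _ = _ := by ring

lemma integral_excess_eq_gammaCoeff (hC : 0 < C) (hβ : 0 < β) (hδ : 0 < δ) {l : ℕ}
    (hl : (l : ℝ) < 1 / β - 1 / 2) :
    ∫ t in Ioi (0 : ℝ), excess C β δ (l + 1 / 2) t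
      = gammaCoeff C β l * δ ^ (-(1 / β) + l + 1 / 2) := by
  rw [integral_excess hC hβ hδ (by positivity) (by linarith), gammaCoeff,
    show (l : ℝ) + 1 / 2 + 1 = l + 3 / 2 by ring,
    show 1 / β - ((l : ℝ) + 1 / 2) = 1 / β - 1 / 2 - l by ring,
    show (l : ℝ) + 1 / 2 - 1 / β = -(1 / β) + l + 1 / 2 by ring]

lemma exists_abs_log_turanLim_sub_gammaCoeff_le {c : ℕ → ℝ} (hc : IsArcoshTaylorCoeff c)
    (hC : 0 < C) (hβ : 0 < β) : ∃ A B : ℝ, ∀ δ : ℝ, 0 < δ → δ ≤ C → δ ≤ 1 →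
      |1 / 2 * Real.log (turanLim (powerPotential C β) (2 - δ))
        - ∑ l ∈ Finset.range ⌈1 / β - 1 / 2⌉₊,
          c l * gammaCoeff C β l * δ ^ (-(1 / β) + l + 1 / 2)| ≤ A + B * (-Real.log δ) := by
  obtain ⟨A1, B1, h1⟩ := exists_abs_log_turanLim_sub_le hC hβ
  obtain ⟨A2, B2, h2⟩ := exists_abs_sum_growthRate_sub_le hc hC hβ
  -- The condition on l sits behind the quantifier over K so that one bound can be chosen for every
  -- l; it is irrelevant past the threshold.
  have h3 : ∀ l : ℕ, ∃ K : ℝ, (l : ℝ) < 1 / β - 1 / 2 → ∀ δ : ℝ, 0 < δ →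
      |∑ k ∈ Finset.range (forbiddenCount C β δ), excess C β δ (l + 1 / 2) ((k + 1 : ℕ) : ℝ)
        - gammaCoeff C β l * δ ^ (-(1 / β) + l + 1 / 2)| ≤ K := by
    intro l
    by_cases hl : (l : ℝ) < 1 / β - 1 / 2
    · obtain ⟨K, hK⟩ := exists_abs_sum_excess_sub_le (s := l + 1 / 2) hC hβ (by positivity)
        (by linarith)
      exact ⟨K, fun _ δ hδ => by
        rw [← integral_excess_eq_gammaCoeff hC hβ hδ hl]; exact hK δ hδ⟩
    · exact ⟨0, fun h => absurd h hl⟩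
  choose K hK using h3
  set L := ⌈1 / β - 1 / 2⌉₊
  refine ⟨A1 + A2 + ∑ l ∈ Finset.range L, |c l| * K l, B1 + B2, fun δ hδ hδC hδ1 => ?_⟩
  have g1 := h1 δ hδ hδC hδ1
  have g2 := h2 δ hδ hδC
  set S := ∑ k ∈ Finset.range (forbiddenCount C β δ), growthRate C β δ (k + 1)
  have g3 : |∑ l ∈ Finset.range L, c l * ∑ k ∈ Finset.range (forbiddenCount C β δ),
        excess C β δ (l + 1 / 2) ((k + 1 : ℕ) : ℝ)
      - ∑ l ∈ Finset.range L, c l * gammaCoeff C β l * δ ^ (-(1 / β) + l + 1 / 2)|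
      ≤ ∑ l ∈ Finset.range L, |c l| * K l := by
    rw [← Finset.sum_sub_distrib]
    refine (Finset.abs_sum_le_sum_abs _ _).trans (Finset.sum_le_sum fun l hl => ?_)
    rw [mul_assoc, ← mul_sub, abs_mul]
    exact mul_le_mul_of_nonneg_left (hK l (Nat.lt_ceil.1 (Finset.mem_range.1 hl)) δ hδ)
      (abs_nonneg _)
  rw [abs_le] at g1 g2 g3 ⊢
  constructor <;> linarith [g1.1, g1.2, g2.1, g2.2, g3.1, g3.2]

end PowerPotential

/-! ### Passage to O-terms as x ↑ 2, and conclusion. -/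

lemma isBigO_log_of_abs_le {f : ℝ → ℝ} {A B d : ℝ} (hd : 0 < d)
    (h : ∀ δ : ℝ, 0 < δ → δ ≤ d → |f (2 - δ)| ≤ A + B * (-Real.log δ)) :
    f =O[𝓝[<] 2] fun x => Real.log (2 - x) := by
  refine IsBigO.of_bound (|A| + |B|) ?_
  -- Below exp(-1) the logarithm is at most -1, so it absorbs the constant A.
  have hm : Ioo (2 - min d (Real.exp (-1))) 2 ∈ 𝓝[<] (2 : ℝ) :=
    Ioo_mem_nhdsLT (by have := Real.exp_pos (-1); have := lt_min hd this; linarith)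
  filter_upwards [hm] with x hx
  have h0 : 0 < 2 - x := by linarith [hx.2]
  have h1 : 2 - x ≤ d := by linarith [hx.1, min_le_left d (Real.exp (-1))]
  have h2 : 2 - x ≤ Real.exp (-1) := by linarith [hx.1, min_le_right d (Real.exp (-1))]
  have h3 : Real.log (2 - x) ≤ -1 := by
    have := Real.log_le_log h0 h2
    rwa [Real.log_exp] at this
  have h4 := h (2 - x) h0 h1
  rw [sub_sub_cancel] at h4
  rw [Real.norm_eq_abs, Real.norm_eq_abs, abs_of_nonpos (by linarith : Real.log (2 - x) ≤ 0)]
  nlinarith [le_abs_self A, le_abs_self B, abs_nonneg A, abs_nonneg B]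

lemma tendsto_two_sub : Tendsto (fun x : ℝ => 2 - x) (𝓝[<] 2) (𝓝[>] 0) := by
  refine tendsto_nhdsWithin_iff.2 ⟨?_, ?_⟩
  · have : Tendsto (fun x : ℝ => 2 - x) (𝓝 2) (𝓝 (2 - 2)) := by
      apply Continuous.tendsto; fun_prop
    rw [sub_self] at this
    exact this.mono_left nhdsWithin_le_nhds
  · filter_upwards [self_mem_nhdsWithin] with x hx
    exact sub_pos.2 (mem_Iio.1 hx)

/-- An expansion whose leading term dominates all others by a factor `2 - x`. -/
lemma exists_relative_error {Q : ℝ → ℝ} {a : ℕ → ℝ} {β : ℝ} (hβ : 0 < β) (hβ2 : β < 2 / 3)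
    (ha : a 0 ≠ 0)
    (h : (fun x => Q x - ∑ l ∈ Finset.range ⌈1 / β - 1 / 2⌉₊,
      a l * (2 - x) ^ (-(1 / β) + l + 1 / 2)) =O[𝓝[<] 2] fun x => Real.log (2 - x)) :
    ∃ E : ℝ → ℝ, (E =O[𝓝[<] 2] fun x => 2 - x) ∧
      ∀ᶠ x in 𝓝[<] 2, Q x = a 0 * (2 - x) ^ (1 / 2 - 1 / β) * (1 + E x) := by
  set p := 1 / 2 - 1 / β with hp
  -- This is where β < 2/3 enters: the logarithm and all terms with l ≥ 1 are then O((2 - x)^(p +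
  -- 1)).
  have hp1 : p + 1 < 0 := by
    have : 3 / 2 < 1 / β := by rw [lt_div_iff₀ hβ]; linarith
    linarith
  have hpos : ∀ᶠ x : ℝ in 𝓝[<] 2, 0 < 2 - x := tendsto_two_sub self_mem_nhdsWithin
  have hle1 : ∀ᶠ x : ℝ in 𝓝[<] 2, 2 - x ≤ 1 := by
    filter_upwards [Ioo_mem_nhdsLT (show (1 : ℝ) < 2 by norm_num)] with x hx
    linarith [hx.1]
  obtain ⟨L, hL⟩ : ∃ L, ⌈1 / β - 1 / 2⌉₊ = L + 1 :=
    ⟨⌈1 / β - 1 / 2⌉₊ - 1, (Nat.sub_add_cancel (Nat.ceil_pos.2 (by linarith))).symm⟩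
  rw [hL] at h
  have hlog : (fun x : ℝ => Real.log (2 - x)) =O[𝓝[<] 2] fun x => (2 - x) ^ (p + 1) :=
    ((isLittleO_log_rpow_nhdsGT_zero hp1).comp_tendsto tendsto_two_sub).isBigO
  have hsum : (fun x : ℝ => ∑ l ∈ Finset.range L, a (l + 1) *
      (2 - x) ^ (-(1 / β) + ((l + 1 : ℕ) : ℝ) + 1 / 2)) =O[𝓝[<] 2] fun x => (2 - x) ^ (p + 1) := by
    refine IsBigO.fun_sum fun l _ => IsBigO.const_mul_left ?_ _
    refine IsBigO.of_bound 1 ?_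
    filter_upwards [hpos, hle1] with x h0 h1
    rw [Real.norm_of_nonneg (by positivity), Real.norm_of_nonneg (by positivity), one_mul]
    refine Real.rpow_le_rpow_of_exponent_ge h0 h1 ?_
    push_cast
    linarith [l.cast_nonneg (α := ℝ)]
  have hmain : (fun x => Q x - a 0 * (2 - x) ^ p) =O[𝓝[<] 2] fun x => (2 - x) ^ (p + 1) := by
    refine ((h.trans hlog).add hsum).congr_left fun x => ?_
    rw [Finset.sum_range_succ', Nat.cast_zero, show -(1 / β) + 0 + 1 / 2 = p by rw [hp]; ring]
    ring
  refine ⟨fun x => (Q x - a 0 * (2 - x) ^ p) * (a 0 * (2 - x) ^ p)⁻¹, ?_, ?_⟩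
  · have h2 : (fun x : ℝ => (a 0 * (2 - x) ^ p)⁻¹) =O[𝓝[<] 2] fun x => ((2 - x) ^ p)⁻¹ := by
      simp only [mul_inv]
      exact (isBigO_refl _ _).const_mul_left _
    refine (hmain.mul h2).congr' EventuallyEq.rfl ?_
    filter_upwards [hpos] with x h0
    rw [Real.rpow_add h0, Real.rpow_one]
    have := (Real.rpow_pos_of_pos h0 p).ne'
    field_simp
  · filter_upwards [hpos] with x h0
    have := (Real.rpow_pos_of_pos h0 p).ne'
    field_simp
    ring

theorem mainTheorem4 :
    ∃ c : ℕ → ℝ, IsArcoshTaylorCoeff c ∧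
      ∀ C β : ℝ, 0 < C → 0 < β → ∀ μ : Measure ℝ,
        HasJacobiParameters μ (fun _ => 1) (fun n => -C * (n : ℝ) ^ (-β)) →
        ∃ Q : ℝ → ℝ, HasExponentOnInterval μ Q ∧
          ((fun x => Q x - ∑ l ∈ Finset.range ⌈1 / β - 1 / 2⌉₊,
              c l * gammaCoeff C β l * (2 - x) ^ (-(1 / β) + l + 1 / 2))
            =O[𝓝[<] 2] fun x => Real.log (2 - x)) ∧
          (β < 2 / 3 →
            ∃ E : ℝ → ℝ, (E =O[𝓝[<] 2] fun x => 2 - x) ∧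
              ∀ᶠ x in 𝓝[<] 2,
                Q x = gammaCoeff C β 0 * (2 - x) ^ (1 / 2 - 1 / β) * (1 + E x)) := by
  refine ⟨arcoshCoeff, isArcoshTaylorCoeff_arcoshCoeff, fun C β hC hβ μ hμ => ?_⟩
  change HasJacobiParameters μ (fun _ => 1) (powerPotential C β) at hμ
  have hb : MonotoneOn (powerPotential C β) (Ici 1) := monotoneOn_powerPotential hC hβ
  have hb0 : ∀ n, powerPotential C β (n + 1) ≤ 0 := fun n => powerPotential_nonpos hC _
  have hlim : Tendsto (powerPotential C β) atTop (𝓝 0) := tendsto_powerPotential hβ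
  set w := jacobiWeight (powerPotential C β) with hw
  have hwpos : ∀ x ∈ Ioo (-2 : ℝ) 2, 0 < w x := fun x hx => jacobiWeight_pos hb hb0 hlim hx
  set Q : ℝ → ℝ := fun x => -(1 / 2) * Real.log (w x) with hQ
  have hexp : HasExponentOnInterval μ Q := by
    refine ⟨continuousOn_const.mul
      ((continuousOn_jacobiWeight hb hb0 hlim).log fun x hx => (hwpos x hx).ne'), ?_⟩
    rw [restrict_eq_withDensity_jacobiWeight hμ hb hb0 hlim]
    refine withDensity_congr_ae ?_
    filter_upwards [ae_restrict_mem measurableSet_Ioo] with x hx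
    have : -2 * Q x = Real.log (w x) := by rw [hQ]; ring
    rw [this, Real.exp_log (hwpos x hx)]
  have hO : (fun x => Q x - ∑ l ∈ Finset.range ⌈1 / β - 1 / 2⌉₊,
      arcoshCoeff l * gammaCoeff C β l * (2 - x) ^ (-(1 / β) + l + 1 / 2))
      =O[𝓝[<] 2] fun x => Real.log (2 - x) := by
    obtain ⟨A, B, h⟩ :=
      exists_abs_log_turanLim_sub_gammaCoeff_le isArcoshTaylorCoeff_arcoshCoeff hC hβ
    refine isBigO_log_of_abs_le (A := A + |1 / 2 * Real.log (2 * Real.pi)| + Real.log 4 / 4)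
      (B := B + 1 / 4) (lt_min one_pos hC) fun δ hδ hδm => ?_
    have hδ1 : δ ≤ 1 := hδm.trans (min_le_left _ _)
    have hx : 2 - δ ∈ Ioo (-2 : ℝ) 2 := ⟨by linarith, by linarith⟩
    have h1 := h δ hδ (hδm.trans (min_le_right _ _)) hδ1
    have hT := turanLim_pos hb hb0 hlim hx
    have e4 : 4 - (2 - δ) ^ 2 = δ * (4 - δ) := by ring
    have h4 : 0 < 4 - δ := by linarith
    -- The quarters come from the square root of 4 - x² = δ(4 - δ) and the factor 1/2 in Q.
    have e : Q (2 - δ) = 1 / 2 * Real.log (turanLim (powerPotential C β) (2 - δ))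
        + 1 / 2 * Real.log (2 * Real.pi) + 1 / 4 * (-Real.log δ) - 1 / 4 * Real.log (4 - δ) := by
      have hpi := Real.pi_pos
      rw [hQ, hw]
      simp only [jacobiWeight]
      rw [e4, Real.log_div (by positivity) hT.ne', Real.log_div (by positivity) (by positivity),
        Real.log_sqrt (by positivity), Real.log_mul hδ.ne' h4.ne']
      ring
    have h5 : 0 ≤ Real.log (4 - δ) := Real.log_nonneg (by linarith)
    have h6 : Real.log (4 - δ) ≤ Real.log 4 := Real.log_le_log h4 (by linarith)
    have h7 : Real.log δ ≤ 0 := Real.log_nonpos hδ.le hδ1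
    have h8 := abs_le.1 (le_refl |1 / 2 * Real.log (2 * Real.pi)|)
    rw [sub_sub_cancel, e]
    rw [abs_le] at h1 ⊢
    constructor <;> linarith [h1.1, h1.2, h8.1, h8.2]
  refine ⟨Q, hexp, hO, fun hβ2 => ?_⟩
  have hβ1 : 3 / 2 < 1 / β := by rw [lt_div_iff₀ hβ]; linarith
  have hg : arcoshCoeff 0 * gammaCoeff C β 0 ≠ 0 := by
    have g1 := Real.Gamma_pos_of_pos (show (0 : ℝ) < (0 : ℕ) + 3 / 2 by norm_num)
    have g2 := Real.Gamma_pos_of_pos (show (0 : ℝ) < 1 / β - 1 / 2 - (0 : ℕ) by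
      push_cast; linarith)
    have g3 := Real.Gamma_pos_of_pos (show (0 : ℝ) < 1 / β + 1 by linarith)
    rw [arcoshCoeff_zero, one_mul, gammaCoeff]
    positivity
  have := exists_relative_error (a := fun l => arcoshCoeff l * gammaCoeff C β l) hβ hβ2 hg hO
  simpa only [arcoshCoeff_zero, one_mul] using this
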